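/- Let $f:\mathbb{R}^n\to\mathbb{R}$ be $\mathcal{C}^2$, and let $\mathbf 0$ be a critical point of $f$ with $f(\mathbf 0)=0$, with invertible Hessian and with Morse index $m\ge 1$. Write $\mathbb{B}(\mathbf 0,r)$ for the open ball, $|\cdot|$ for the Euclidean norm, and $\mathrm{lev}_{\ge l}f=\{f\ge l\}$, $\mathrm{lev}_{\le l}f=\{f\le l\}$. **The min-max problem.** For $r>0$ and $l\le 0$ consider $$\min_{S}\ \max_{x,y\in S\cap(\mathrm{lev}_{\ge l}f)\cap \mathbb{B}(\mathbf 0,r)}|x-y| ,\qquad (\ast)$$ where $S$ ranges over the $m$-dimensional affine subspaces of $\mathbb{R}^n$ for which $S\cap(\mathrm{lev}_{\ge l}f)\cap\mathbb{B}(\mathbf 0,r)$ is nonempty and closed (in $\mathbb{R}^n$). An optimizing triple $(S',x,y)$ consists of a minimizing $S'$ and a pair $(x,y)$ that attains the inner maximum for $S=S'$. **The subspace-finding algorithm**, applied to $x\ne y$ at level $l$, with $z=\frac12(x+y)$: put $X_1=\mathrm{span}\{x-y\}$; for $j=1,\dots,m-1$ let $\bar p_{j+1}$ be a closest point to $z$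 in $\mathrm{lev}_{\le l}f\cap(z+X_j^\perp)$ and put $X_{j+1}=\mathrm{span}(X_j\cup\{\bar p_{j+1}-z\})$; return $X_m$. **The fast local level-set method** with $U_i=\mathbb{B}(\mathbf 0,r)$ and starting level $l_0<0$. At iteration $i$: (1) find an optimizing triple $(S_i',x_i,y_i)$ of $(\ast)$ for $l=l_i$ and put $z_i=\frac12(x_i+y_i)$; (2) if $x_i=y_i$, stop (the stopped run is regarded as continued with $l_{i+1}=l_i$); otherwise take a linear subspace $L_i$ returned by the subspace-finding algorithm for $(x_i,y_i)$ at level $l_i$ (the lineality space of $S_i=z_i+L_i$); (3) let $l_{i+1}=\inf\{f(w): w\in(z_i+L_i^\perp)\cap\mathbb{B}(\mathbf 0,r)\}$. **Uniqueness assumption.** At each iteration the triple in (1) is such that $(x_i,y_i)$ is, up to exchanging the two points, the only pair of points of $S_i'\cap(\mathrm{lev}_{\ge l_i}f)\cap\mathbb{B}(\mathbf 0,r)$ whose distance is the diameter of that set. **Rates.** A sequence $\alpha_i\ge0$ with $\alpha_i\to 0$ converges Q-linearly if there is $\rho\in(0,1)$ with $\alpha_{i+1}\le\rho\,\alpha_i$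 for all large $i$, and Q-superlinearly if $\alpha_{i+1}=o(\alpha_i)$. It converges R-linearly (R-superlinearly) if it is bounded above termwise by a Q-linearly (Q-superlinearly) convergent sequence of positive numbers. **Theorem.** There are $\varepsilon>0$ and $R>0$ such that for every $0<r<R$ there is $\eta>0$ with the following properties. (a) If $-\eta<l<0$ and $(S',x,y)$ is an optimizing triple of $(\ast)$ that satisfies the uniqueness assumption, then the iteration can be carried out: $x\ne y$, the subspace-finding algorithm can be completed, every subspace $X$ that it returns has dimension $m$, and the next level $l'=\inf\{f(w):w\in(z+X^\perp)\cap\mathbb{B}(\mathbf 0,r)\}$, where $z=\frac12(x+y)$, satisfies $l<l'\le 0$. (b) For every run of the method with $-\eta<l_0<0$ under the uniqueness assumption, $|x_i|$, $|y_i|$ and $|z_i|$ converge R-superlinearly to $0$ (R-superlinear convergence to the critical point $\mathbf 0$), and $|l_i|$ converges Q-superlinearly to $0$ (Q-superlinear convergence to the critical value $0$). (c) Suppose that in step (2) the subspace $L_i$ is instead any $m$-dimensional linear subspace whose orthogonal projection differs by at most $\varepsilon$ in operator norm from the orthogonal projection onto a subspace that the subspace-finding algorithm can return at this iteration, or from that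 onto the sum of the eigenspaces of $\nabla^2f(\mathbf 0)$ for negative eigenvalues. Then for every such run with $-\eta<l_0<0$ under the uniqueness assumption, $|x_i|$, $|y_i|$ and $|z_i|$ converge R-linearly to $0$ and $|l_i|$ converges Q-linearly to $0$. -/

import Mathlib

open Filter Topology Asymptotics

/-- The ambient space `ℝⁿ` with its Euclidean norm. -/
abbrev RSpace (n : ℕ) : Type := EuclideanSpace ℝ (Fin n)

noncomputable section

namespace LevelSet

variable {n : ℕ}

/-! ### Critical points -/

/-- The Hessian of `f` at `p`, as the derivative of the gradient map. -/
def hessian (f : RSpace n → ℝ) (p : RSpace n) : RSpace n →L[ℝ] RSpace n :=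
  fderiv ℝ (gradient f) p

/-- `p` is a critical point of `f` whose Hessian is invertible. -/
def IsNondegenerateCriticalPoint (f : RSpace n → ℝ) (p : RSpace n) : Prop :=
  gradient f p = 0 ∧ IsUnit (hessian f p)

/-- `m` is the Morse index of `f` at `p`: the maximal dimension of a linear subspace on which the
Hessian is negative definite. -/
def HasMorseIndex (f : RSpace n → ℝ) (p : RSpace n) (m : ℕ) : Prop :=
  IsGreatest {k : ℕ | ∃ V : Submodule ℝ (RSpace n), Module.finrank ℝ V = k ∧
    ∀ v ∈ V, v ≠ 0 → inner ℝ (hessian f p v) v < 0} m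

/-- The sum of the eigenspaces of the Hessian at `p` that belong to negative eigenvalues. -/
def negEigenspace (f : RSpace n → ℝ) (p : RSpace n) : Submodule ℝ (RSpace n) :=
  ⨆ μ : {μ : ℝ // μ < 0},
    Module.End.eigenspace (hessian f p : RSpace n →ₗ[ℝ] RSpace n) (μ : ℝ)

/-! ### The min-max problem -/

/-- The slice `S ∩ lev_{≥ l} f ∩ U`. -/
def slice (f : RSpace n → ℝ) (U : Set (RSpace n)) (l : ℝ) (S : AffineSubspace ℝ (RSpace n)) :
    Set (RSpace n) :=
  {p | p ∈ S ∧ l ≤ f p ∧ p ∈ U}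

/-- The `m`-dimensional affine subspaces that compete in the min-max problem: those with a
nonempty closed slice (in particular they meet `U`). -/
def Admissible (f : RSpace n → ℝ) (m : ℕ) (U : Set (RSpace n)) (l : ℝ)
    (S : AffineSubspace ℝ (RSpace n)) : Prop :=
  Module.finrank ℝ S.direction = m ∧ (slice f U l S).Nonempty ∧ IsClosed (slice f U l S)

/-- `(S, x, y)` is an optimizing triple of `min_S max_{x, y ∈ S ∩ lev_{≥ l} f ∩ U} |x - y|`, the
minimum being over the admissible `S`. It is used for bounded `U`, where `Metric.diam` is the
supremum of the distances. -/
def IsOptimizingTriple (f : RSpace n → ℝ) (m : ℕ) (U : Set (RSpace n)) (l : ℝ)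
    (S : AffineSubspace ℝ (RSpace n)) (x y : RSpace n) : Prop :=
  Admissible f m U l S ∧ x ∈ slice f U l S ∧ y ∈ slice f U l S ∧
    dist x y = Metric.diam (slice f U l S) ∧
    ∀ S' : AffineSubspace ℝ (RSpace n), Admissible f m U l S' →
      Metric.diam (slice f U l S) ≤ Metric.diam (slice f U l S')

/-- `(x, y)` is, up to exchanging the two points, the only pair of points of `K` whose distance is
the diameter of `K`. -/
def IsUniqueDiameterPair (K : Set (RSpace n)) (x y : RSpace n) : Prop :=
  x ∈ K ∧ y ∈ K ∧ dist x y = Metric.diam K ∧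
    ∀ x' ∈ K, ∀ y' ∈ K, dist x' y' = Metric.diam K → (x' = x ∧ y' = y) ∨ (x' = y ∧ y' = x)

/-- An optimizing triple whose pair of points is the unique diameter-attaining pair. -/
def IsUniqueOptimizingTriple (f : RSpace n → ℝ) (m : ℕ) (U : Set (RSpace n)) (l : ℝ)
    (S : AffineSubspace ℝ (RSpace n)) (x y : RSpace n) : Prop :=
  IsOptimizingTriple f m U l S x y ∧ IsUniqueDiameterPair (slice f U l S) x y

/-! ### The subspace-finding algorithm -/

/-- `p` is a closest point to `z` in `lev_{≤ l} f ∩ (z + Xᗮ)`. -/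
def IsClosestPoint (f : RSpace n → ℝ) (l : ℝ) (z : RSpace n) (X : Submodule ℝ (RSpace n))
    (p : RSpace n) : Prop :=
  (f p ≤ l ∧ p - z ∈ Xᗮ) ∧ ∀ q : RSpace n, f q ≤ l → q - z ∈ Xᗮ → dist z p ≤ dist z q

/-- `FindSubspace f l x y j X`: the subspace-finding algorithm, started from the pair `(x, y)` at
level `l`, can produce `X` as its `j`-th subspace `X_j`. -/
inductive FindSubspace (f : RSpace n → ℝ) (l : ℝ) (x y : RSpace n) :
    ℕ → Submodule ℝ (RSpace n) → Prop
  | start : FindSubspace f l x y 1 (Submodule.span ℝ {x - y})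
  | extend {j : ℕ} {X : Submodule ℝ (RSpace n)} {p : RSpace n}
      (hX : FindSubspace f l x y j X) (hp : IsClosestPoint f l (midpoint ℝ x y) X p) :
      FindSubspace f l x y (j + 1) (X ⊔ Submodule.span ℝ {p - midpoint ℝ x y})

/-- `L` is an `m`-dimensional linear subspace that approximates, up to `ε` in the operator norm of
the orthogonal projections, the negative eigenspace of the Hessian of `f` at `0` or a subspace
which the subspace-finding algorithm can return for `(x, y)` at level `l`. -/
def ApproxSubspace (f : RSpace n → ℝ) (m : ℕ) (ε : ℝ) (l : ℝ) (x y : RSpace n)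
    (L : Submodule ℝ (RSpace n)) : Prop :=
  Module.finrank ℝ L = m ∧
    (‖L.starProjection - (negEigenspace f 0).starProjection‖ ≤ ε ∨
      ∃ X : Submodule ℝ (RSpace n), FindSubspace f l x y m X ∧
        ‖L.starProjection - X.starProjection‖ ≤ ε)

/-! ### The fast local level-set method -/

/-- `l'` is the greatest lower bound of `f` on the part in `U` of the affine space through the
midpoint of `x` and `y` whose lineality space is `Lᗮ`. -/
def IsNextLevel (f : RSpace n → ℝ) (U : Set (RSpace n)) (x y : RSpace n)
    (L : Submodule ℝ (RSpace n)) (l' : ℝ) : Prop :=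
  IsGLB (f '' {w | w ∈ U ∧ w - midpoint ℝ x y ∈ Lᗮ}) l'

/-- The sequences `l`, `x`, `y` are produced by the fast local method with `U_i = U`, where at
each iteration the points come from an optimizing triple with unique diameter-attaining pair, and
where `Sel l x y L` says that `L` may be used as the lineality space of `S_i`. A run stops
once `x_i = y_i`; a stopped run is continued with the same level. -/
def IsRun (f : RSpace n → ℝ) (m : ℕ) (U : Set (RSpace n))
    (Sel : ℝ → RSpace n → RSpace n → Submodule ℝ (RSpace n) → Prop)
    (l : ℕ → ℝ) (x y : ℕ → RSpace n) : Prop :=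
  ∀ i : ℕ,
    (∃ S : AffineSubspace ℝ (RSpace n), IsUniqueOptimizingTriple f m U (l i) S (x i) (y i)) ∧
    (x i = y i → l (i + 1) = l i) ∧
    (x i ≠ y i → ∃ L : Submodule ℝ (RSpace n),
      Sel (l i) (x i) (y i) L ∧ IsNextLevel f U (x i) (y i) L (l (i + 1)))

/-! ### Rates of convergence (for sequences of nonnegative numbers) -/

/-- Q-linear convergence to `0`; for positive numbers, `limsup α_{i+1} / α_i < 1`. -/
def QLinear (α : ℕ → ℝ) : Prop :=
  Tendsto α atTop (𝓝 0) ∧ ∃ ρ : ℝ, 0 < ρ ∧ ρ < 1 ∧ ∀ᶠ i in atTop, α (i + 1) ≤ ρ * α i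

/-- Q-superlinear convergence to `0`; for positive numbers, `α_{i+1} / α_i → 0`. -/
def QSuperlinear (α : ℕ → ℝ) : Prop :=
  Tendsto α atTop (𝓝 0) ∧ (fun i => α (i + 1)) =o[atTop] α

/-- R-linear convergence to `0`. -/
def RLinear (α : ℕ → ℝ) : Prop :=
  ∃ β : ℕ → ℝ, (∀ i, 0 < β i) ∧ QLinear β ∧ ∀ i, α i ≤ β i

/-- R-superlinear convergence to `0`. -/
def RSuperlinear (α : ℕ → ℝ) : Prop :=
  ∃ β : ℕ → ℝ, (∀ i, 0 < β i) ∧ QSuperlinear β ∧ ∀ i, α i ≤ β i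

end LevelSet

end

open Filter Topology Asymptotics

namespace LevelSet

variable {n : ℕ}

/-- `H` is a symmetric operator that is negative definite on the `m`-dimensional subspace `N` and
positive definite on its orthogonal complement. -/
structure SaddleForm (H : RSpace n →L[ℝ] RSpace n) (N : Submodule ℝ (RSpace n)) (m : ℕ)
    (c C : ℝ) : Prop where
  symm : ∀ a b, inner ℝ (H a) b = inner ℝ a (H b)
  norm_le : ‖H‖ ≤ C
  c_pos : 0 < c
  c_le : c ≤ C
  finrank_eq : Module.finrank ℝ N = m
  neg : ∀ v ∈ N, inner ℝ (H v) v ≤ -c * ‖v‖ ^ 2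
  pos : ∀ w ∈ Nᗮ, c * ‖w‖ ^ 2 ≤ inner ℝ (H w) w

/-- On the ball of radius `R` the gradient `G` of `f` is `δ`-close to the linear map `H`. -/
structure QuadModel (f : RSpace n → ℝ) (G : RSpace n → RSpace n) (H : RSpace n →L[ℝ] RSpace n)
    (δ R : ℝ) : Prop where
  grad : ∀ x, HasGradientAt f (G x) x
  approx : ∀ a b, ‖a‖ < R → ‖b‖ < R → ‖G b - G a - H (b - a)‖ ≤ δ * ‖b - a‖
  grad_continuous : Continuous G
  map_zero : f 0 = 0
  grad_zero : G 0 = 0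

section Hessian

variable {f : RSpace n → ℝ}

theorem contDiff_gradient (hf : ContDiff ℝ 2 f) : ContDiff ℝ 1 (gradient f) := by
  have h : gradient f = fun x => (InnerProductSpace.toDual ℝ (RSpace n)).symm (fderiv ℝ f x) := rfl
  rw [h]
  exact (LinearIsometryEquiv.contDiff _).comp (hf.fderiv_right (m := 1) (by norm_num))

theorem hessian_inner (hf : ContDiff ℝ 2 f) (a b : RSpace n) :
    inner ℝ (hessian f 0 a) b = fderiv ℝ (fderiv ℝ f) 0 a b := by
  have h1 : DifferentiableAt ℝ (fderiv ℝ f) 0 :=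
    (hf.fderiv_right (m := 1) (by norm_num)).differentiable (by norm_num) 0
  have h : gradient f = (InnerProductSpace.toDual ℝ (RSpace n)).symm ∘ (fderiv ℝ f) := rfl
  have h2 : hessian f 0 a = (InnerProductSpace.toDual ℝ (RSpace n)).symm
      (fderiv ℝ (fderiv ℝ f) 0 a) := by
    unfold hessian
    rw [h, LinearIsometryEquiv.comp_fderiv]
    rfl
  rw [h2, InnerProductSpace.toDual_symm_apply]

theorem hessian_symm (hf : ContDiff ℝ 2 f) (a b : RSpace n) :
    inner ℝ (hessian f 0 a) b = inner ℝ a (hessian f 0 b) := by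
  rw [hessian_inner hf, real_inner_comm, hessian_inner hf]
  exact (hf.contDiffAt.isSymmSndFDerivAt (by simp)) a b

theorem exists_quadModel (hf : ContDiff ℝ 2 f) (hcrit : gradient f 0 = 0) (hf0 : f 0 = 0)
    {δ : ℝ} (hδ : 0 < δ) : ∃ R > 0, QuadModel f (gradient f) (hessian f 0) δ R := by
  have hs : HasStrictFDerivAt (gradient f) (hessian f 0) 0 :=
    (contDiff_gradient hf).contDiffAt.hasStrictFDerivAt (by norm_num)
  have h := hs.isLittleO.def hδ
  rw [nhds_prod_eq] at h
  obtain ⟨R, hR, hb⟩ := (Metric.eventually_nhds_iff.1 (by rwa [← nhds_prod_eq] at h))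
  refine ⟨R, hR, ⟨fun x => ?_, fun a b ha hb' => ?_,
    (contDiff_gradient hf).continuous, hf0, hcrit⟩⟩
  · exact (hf.differentiable (by norm_num) x).hasGradientAt
  · have := hb (y := (b, a)) (by
      rw [Prod.dist_eq]
      simp only [dist_zero_right]
      exact max_lt hb' ha)
    exact this

theorem exists_saddleForm {m : ℕ} (hf : ContDiff ℝ 2 f)
    (hcrit : IsNondegenerateCriticalPoint f 0) (hindex : HasMorseIndex f 0 m) :
    ∃ c C : ℝ, SaddleForm (hessian f 0) (negEigenspace f 0) m c C := by
  classical
  set H := hessian f 0 with hH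
  have hsym : (H : RSpace n →ₗ[ℝ] RSpace n).IsSymmetric := fun a b => hessian_symm hf a b
  have hn : Module.finrank ℝ (RSpace n) = n := by simp
  set e := hsym.eigenvectorBasis hn
  set ev := hsym.eigenvalues hn
  have hHe : ∀ i, H (e i) = ev i • e i := fun i => hsym.apply_eigenvectorBasis hn i
  have hinj : Function.Injective H := by
    obtain ⟨u, hu⟩ := hcrit.2
    intro a b hab
    have hl : ∀ a, (↑u⁻¹ : RSpace n →L[ℝ] RSpace n) (H a) = a := fun a => by
      have := congrArg (fun T : RSpace n →L[ℝ] RSpace n => T a) u.inv_mul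
      rw [hu] at this
      exact this
    rw [← hl a, ← hl b, hab]
  have hne : ∀ i, ev i ≠ 0 := by
    intro i h0
    have h1 : H (e i) = H 0 := by rw [hHe, h0]; simp
    have h2 := hinj h1
    have h3 : ‖e i‖ = 1 := e.orthonormal.1 i
    rw [h2] at h3
    simp at h3
  obtain ⟨c, hc, hcle⟩ : ∃ c > 0, ∀ i, c ≤ |ev i| := by
    rcases isEmpty_or_nonempty (Fin n) with h | h
    · exact ⟨1, one_pos, fun i => h.elim i⟩
    · obtain ⟨i, hi⟩ := Finite.exists_min (fun i => |ev i|)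
      exact ⟨|ev i|, abs_pos.2 (hne i), hi⟩
  have hquad : ∀ v, inner ℝ (H v) v = ∑ i, ev i * (inner ℝ (e i) v) ^ 2 := by
    intro v
    rw [← e.sum_inner_mul_inner (H v) v]
    refine Finset.sum_congr rfl fun i _ => ?_
    have : inner ℝ (H v) (e i) = ev i * inner ℝ (e i) v := by
      rw [hessian_symm hf, ← hH, hHe, inner_smul_right, real_inner_comm]
    rw [this]; ring
  have hnorm : ∀ v, ‖v‖ ^ 2 = ∑ i, (inner ℝ (e i) v) ^ 2 := by
    intro v
    rw [← real_inner_self_eq_norm_sq, ← e.sum_inner_mul_inner v v]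
    refine Finset.sum_congr rfl fun i _ => ?_
    rw [real_inner_comm]; ring
  have hN : ∀ v ∈ negEigenspace f 0, ∀ i, 0 < ev i → inner ℝ (e i) v = 0 := by
    intro v hv i hi
    have hle : negEigenspace f 0 ≤ (Submodule.span ℝ {e i})ᗮ := by
      refine iSup_le fun μ w hw => ?_
      rw [Submodule.mem_orthogonal_singleton_iff_inner_right]
      rw [Module.End.mem_eigenspace_iff] at hw
      have h1 : inner ℝ (e i) (H w) = (μ : ℝ) * inner ℝ (e i) w := by
        have hw' : H w = (μ : ℝ) • w := hw
        rw [hw', inner_smul_right]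
      have h2 : inner ℝ (e i) (H w) = ev i * inner ℝ (e i) w := by
        rw [← hessian_symm hf, ← hH, hHe, inner_smul_left]; simp
      have h3 : (ev i - μ) * inner ℝ (e i) w = 0 := by rw [sub_mul, ← h1, ← h2, sub_self]
      have hμ : (μ : ℝ) < 0 := μ.2
      exact (mul_eq_zero.1 h3).resolve_left (by linarith)
    exact Submodule.mem_orthogonal_singleton_iff_inner_right.1 (hle hv)
  have hN' : ∀ w ∈ (negEigenspace f 0)ᗮ, ∀ i, ev i < 0 → inner ℝ (e i) w = 0 := by
    intro w hw i hi
    refine (Submodule.mem_orthogonal _ _).1 hw _ ?_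
    refine Submodule.mem_iSup_of_mem ⟨ev i, hi⟩ ?_
    rw [Module.End.mem_eigenspace_iff]
    exact hHe i
  have hneg : ∀ v ∈ negEigenspace f 0, inner ℝ (H v) v ≤ -c * ‖v‖ ^ 2 := by
    intro v hv
    rw [hquad, hnorm, Finset.mul_sum]
    refine Finset.sum_le_sum fun i _ => ?_
    rcases lt_or_gt_of_ne (hne i) with h | h
    · have := hcle i
      rw [abs_of_neg h] at this
      exact mul_le_mul_of_nonneg_right (by linarith) (sq_nonneg _)
    · rw [hN v hv i h]; simp
  have hpos : ∀ w ∈ (negEigenspace f 0)ᗮ, c * ‖w‖ ^ 2 ≤ inner ℝ (H w) w := by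
    intro v hv
    rw [hquad, hnorm, Finset.mul_sum]
    refine Finset.sum_le_sum fun i _ => ?_
    rcases lt_or_gt_of_ne (hne i) with h | h
    · rw [hN' v hv i h]; simp
    · have := hcle i
      rw [abs_of_pos h] at this
      exact mul_le_mul_of_nonneg_right (by linarith) (sq_nonneg _)
  refine ⟨c, max c ‖H‖, hessian_symm hf, le_max_right _ _, hc, le_max_left _ _, ?_, hneg, hpos⟩
  obtain ⟨⟨V, hV, hVneg⟩, hub⟩ := hindex
  apply le_antisymm
  · refine hub ⟨_, rfl, fun v hv hv0 => ?_⟩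
    have h1 := hneg v hv
    have h2 : 0 < c * ‖v‖ ^ 2 := by positivity
    linarith
  · have hdisj : Disjoint V (negEigenspace f 0)ᗮ := by
      rw [Submodule.disjoint_def]
      intro v hv hv'
      by_contra h0
      have h1 := hVneg v hv h0
      have h2 := hpos v hv'
      have h3 : 0 ≤ c * ‖v‖ ^ 2 := by positivity
      linarith
    have h1 := Submodule.finrank_add_finrank_le_of_disjoint hdisj
    have h2 := (negEigenspace f 0).finrank_add_finrank_orthogonal
    omega

end Hessian

theorem SaddleForm.abs_inner_le {H : RSpace n →L[ℝ] RSpace n} {N : Submodule ℝ (RSpace n)} {m : ℕ}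
    {c C : ℝ} (hH : SaddleForm H N m c C) (a b : RSpace n) :
    |inner ℝ (H a) b| ≤ C * ‖a‖ * ‖b‖ := by
  refine (abs_real_inner_le_norm _ _).trans ?_
  gcongr
  exact (H.le_opNorm a).trans (by gcongr; exact hH.norm_le)

theorem SaddleForm.le_norm_apply {H : RSpace n →L[ℝ] RSpace n} {N : Submodule ℝ (RSpace n)} {m : ℕ}
    {c C : ℝ} (hH : SaddleForm H N m c C) (v : RSpace n) : c * ‖v‖ ≤ ‖H v‖ := by
  obtain ⟨a, ha, b, hb, rfl⟩ := N.exists_add_mem_mem_orthogonal v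
  have hab : inner ℝ a b = 0 := (Submodule.mem_orthogonal _ _).1 hb a ha
  have h1 : inner ℝ (H (a + b)) (b - a) = inner ℝ (H b) b - inner ℝ (H a) a := by
    have := hH.symm a b
    rw [map_add, inner_add_left, inner_sub_right, inner_sub_right, this,
      real_inner_comm (H b) a]
    ring
  have h2 : ‖b - a‖ = ‖a + b‖ := by
    have e1 := norm_sub_sq_real b a
    have e2 := norm_add_sq_real a b
    rw [real_inner_comm, hab] at e1
    rw [hab] at e2
    have : ‖b - a‖ ^ 2 = ‖a + b‖ ^ 2 := by rw [e1, e2]; ring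
    exact (pow_left_inj₀ (norm_nonneg _) (norm_nonneg _) two_ne_zero).1 this
  have h3 : ‖a + b‖ ^ 2 = ‖a‖ ^ 2 + ‖b‖ ^ 2 := by rw [norm_add_sq_real, hab]; ring
  have h4 := real_inner_le_norm (H (a + b)) (b - a)
  rw [h1, h2] at h4
  have h5 := hH.neg a ha
  have h6 := hH.pos b hb
  rcases (norm_nonneg (a + b)).eq_or_lt with h0 | h0
  · rw [← h0]; simp
  · refine le_of_mul_le_mul_right ?_ h0
    have h7 : c * ‖a + b‖ * ‖a + b‖ = c * ‖a‖ ^ 2 + c * ‖b‖ ^ 2 := by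
      rw [mul_assoc, ← pow_two, h3]; ring
    linarith

theorem QuadModel.taylor {f : RSpace n → ℝ} {G : RSpace n → RSpace n}
    {H : RSpace n →L[ℝ] RSpace n} {δ R : ℝ} (h : QuadModel f G H δ R)
    {a b : RSpace n} (ha : ‖a‖ < R) (hb : ‖b‖ < R) (hδ : 0 ≤ δ) :
    |f b - f a - inner ℝ (G a) (b - a) - inner ℝ (H (b - a)) (b - a) / 2| ≤ δ * ‖b - a‖ ^ 2 := by
  set d := b - a with hd
  let φ : ℝ → ℝ := fun t => f (a + t • d) - t * inner ℝ (G a) d - t ^ 2 / 2 * inner ℝ (H d) d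
  have hφ : ∀ t, HasDerivAt φ (inner ℝ (G (a + t • d) - G a - t • H d) d) t := by
    intro t
    have h1 : HasDerivAt (fun t : ℝ => a + t • d) d t := by
      simpa using ((hasDerivAt_id t).smul_const d).const_add a
    have h2 : HasDerivAt (fun t : ℝ => f (a + t • d)) (inner ℝ (G (a + t • d)) d) t := by
      have := (h.grad (a + t • d)).hasFDerivAt.comp_hasDerivAt t h1
      rw [InnerProductSpace.toDual_apply_apply] at this
      exact this
    have h3 := (h2.sub ((hasDerivAt_id t).mul_const (inner ℝ (G a) d))).sub
      ((((hasDerivAt_id t).pow 2).div_const 2).mul_const (inner ℝ (H d) d))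
    refine h3.congr_deriv ?_
    simp [inner_sub_left, inner_smul_left]
  have hball : ∀ t ∈ Set.Icc (0:ℝ) 1, ‖a + t • d‖ < R := by
    intro t ht
    have := (convex_ball (0 : RSpace n) R).add_smul_sub_mem (x := a) (y := b) (by simpa using ha)
      (by simpa using hb) ht
    simpa using this
  have hbound : ∀ t ∈ Set.Ico (0:ℝ) 1, ‖inner ℝ (G (a + t • d) - G a - t • H d) d‖
      ≤ δ * ‖d‖ ^ 2 := by
    intro t ht
    have h1 := h.approx a (a + t • d) ha (hball t ⟨ht.1, ht.2.le⟩)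
    rw [add_sub_cancel_left, map_smul, norm_smul, Real.norm_of_nonneg ht.1] at h1
    refine (abs_real_inner_le_norm _ _).trans ?_
    have h2 : δ * (t * ‖d‖) ≤ δ * ‖d‖ := by
      gcongr
      exact mul_le_of_le_one_left (norm_nonneg _) ht.2.le
    nlinarith [norm_nonneg d]
  have := norm_image_sub_le_of_norm_deriv_le_segment_01'
    (fun t _ => (hφ t).hasDerivWithinAt) hbound
  simp only [φ, one_smul, zero_smul, add_zero, hd, add_sub_cancel, Real.norm_eq_abs] at this
  rw [hd]
  convert this using 2
  ring

section Slices

variable {f : RSpace n → ℝ} {G : RSpace n → RSpace n} {H : RSpace n →L[ℝ] RSpace n}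
  {N : Submodule ℝ (RSpace n)} {m : ℕ} {c C δ R r l : ℝ} {S : AffineSubspace ℝ (RSpace n)}
  {p : RSpace n}

theorem QuadModel.continuous (h : QuadModel f G H δ R) : Continuous f :=
  continuous_iff_continuousAt.2 fun x => (h.grad x).hasFDerivAt.continuousAt

theorem QuadModel.abs_sub_le (h : QuadModel f G H δ R) {b : RSpace n} (hb : ‖b‖ < R)
    (hδ : 0 ≤ δ) : |f b - inner ℝ (H b) b / 2| ≤ δ * ‖b‖ ^ 2 := by
  have h0 : ‖(0 : RSpace n)‖ < R := by rw [norm_zero]; exact (norm_nonneg _).trans_lt hb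
  have := h.taylor h0 hb hδ
  simpa [h.map_zero, h.grad_zero] using this

theorem QuadModel.norm_grad_sub_le (h : QuadModel f G H δ R) {b : RSpace n} (hb : ‖b‖ < R) :
    ‖G b - H b‖ ≤ δ * ‖b‖ := by
  have h0 : ‖(0 : RSpace n)‖ < R := by rw [norm_zero]; exact (norm_nonneg _).trans_lt hb
  have := h.approx 0 b h0 hb
  simpa [h.grad_zero] using this

theorem QuadModel.abs_inner_le_of_inner_grad_eq_zero (h : QuadModel f G H δ R) {p v : RSpace n}
    (hp : ‖p‖ < R) (hv : inner ℝ (G p) v = 0) : |inner ℝ (H p) v| ≤ δ * ‖p‖ * ‖v‖ := by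
  have h1 := abs_real_inner_le_norm (G p - H p) v
  rw [inner_sub_left, hv, zero_sub, abs_neg] at h1
  exact h1.trans (by gcongr; exact h.norm_grad_sub_le hp)

theorem exists_add_eq_of_disjoint {V W : Submodule ℝ (RSpace n)} (hd : Disjoint V W)
    (hdim : n ≤ Module.finrank ℝ V + Module.finrank ℝ W) (p : RSpace n) :
    ∃ v ∈ V, ∃ w ∈ W, v + w = p := by
  have h1 : V ⊔ W = ⊤ := by
    apply Submodule.eq_top_of_finrank_eq
    have := Submodule.finrank_sup_add_finrank_inf_eq V W
    rw [hd.eq_bot, finrank_bot] at this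
    have h2 := Submodule.finrank_le (V ⊔ W)
    simp at h2 ⊢
    omega
  exact Submodule.mem_sup.1 (h1 ▸ Submodule.mem_top)

theorem isCompact_slice (hS : Admissible f m (Metric.ball 0 r) l S) :
    IsCompact (slice f (Metric.ball 0 r) l S) :=
  Metric.isCompact_of_isClosed_isBounded hS.2.2
    (Metric.isBounded_ball.subset fun _ h => h.2.2)

/-- `p` maximizes `f` on `S ∩ B(0, r)`, and it lies in the slice at level `l`. -/
def IsPeak (f : RSpace n → ℝ) (r l : ℝ) (S : AffineSubspace ℝ (RSpace n)) (p : RSpace n) : Prop :=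
  p ∈ slice f (Metric.ball 0 r) l S ∧ ∀ q ∈ S, ‖q‖ < r → f q ≤ f p

theorem Admissible.exists_isPeak (hS : Admissible f m (Metric.ball 0 r) l S)
    (hf : Continuous f) : ∃ p, IsPeak f r l S p := by
  obtain ⟨p, hp, hmax⟩ := (isCompact_slice hS).exists_isMaxOn hS.2.1 hf.continuousOn
  refine ⟨p, hp, fun q hq hqr => ?_⟩
  by_cases h : l ≤ f q
  · exact hmax ⟨hq, h, by simpa using hqr⟩
  · exact (not_le.1 h).le.trans hp.2.1

theorem eventually_norm_add_smul_lt {p : RSpace n} (v : RSpace n) (hp : ‖p‖ < r) :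
    ∀ᶠ t : ℝ in 𝓝 0, ‖p + t • v‖ < r := by
  have : Continuous fun t : ℝ => ‖p + t • v‖ := by fun_prop
  exact this.continuousAt.eventually_lt continuousAt_const (by simpa using hp)

theorem add_smul_mem {v : RSpace n} (hp : p ∈ S) (hv : v ∈ S.direction) (t : ℝ) :
    p + t • v ∈ S := by
  rw [add_comm]
  exact AffineSubspace.vadd_mem_of_mem_direction (S.direction.smul_mem t hv) hp

theorem QuadModel.hasDerivAt_line (h : QuadModel f G H δ R) (a d : RSpace n) (t : ℝ) :
    HasDerivAt (fun t : ℝ => f (a + t • d)) (inner ℝ (G (a + t • d)) d) t := by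
  have h1 : HasDerivAt (fun t : ℝ => a + t • d) d t := by
    simpa using ((hasDerivAt_id t).smul_const d).const_add a
  have := (h.grad (a + t • d)).hasFDerivAt.comp_hasDerivAt t h1
  rw [InnerProductSpace.toDual_apply_apply] at this
  exact this

theorem IsPeak.norm_lt (hp : IsPeak f r l S p) : ‖p‖ < r := by simpa using hp.1.2.2

theorem IsPeak.inner_grad_eq_zero (hp : IsPeak f r l S p) (h : QuadModel f G H δ R)
    {v : RSpace n} (hv : v ∈ S.direction) : inner ℝ (G p) v = 0 := by
  have h1 := h.hasDerivAt_line p v 0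
  have h2 : IsLocalMax (fun t : ℝ => f (p + t • v)) 0 := by
    filter_upwards [eventually_norm_add_smul_lt v hp.norm_lt] with t ht
    simpa using hp.2 _ (add_smul_mem hp.1.1 hv t) ht
  simpa using h2.hasDerivAt_eq_zero h1

theorem IsPeak.inner_hessian_le (hp : IsPeak f r l S p) (h : QuadModel f G H δ R) (hr : r ≤ R)
    (hδ : 0 ≤ δ) {v : RSpace n} (hv : v ∈ S.direction) :
    inner ℝ (H v) v ≤ 2 * δ * ‖v‖ ^ 2 := by
  obtain ⟨t, ht, ht0⟩ := ((eventually_norm_add_smul_lt v hp.norm_lt).filter_mono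
    (nhdsWithin_le_nhds (s := {0}ᶜ)) |>.and self_mem_nhdsWithin).exists
  have h1 := h.taylor (hp.norm_lt.trans_le hr) (ht.trans_le hr) hδ
  have h2 := hp.2 _ (add_smul_mem hp.1.1 hv t) ht
  simp only [add_sub_cancel_left, inner_smul_right, hp.inner_grad_eq_zero h hv, map_smul,
    inner_smul_left, norm_smul, mul_pow, Real.norm_eq_abs, sq_abs, RCLike.conj_to_real] at h1
  have h3 : 0 < t ^ 2 := by
    have : t ≠ 0 := ht0
    positivity
  have h4 := (abs_le.1 h1).1
  nlinarith

theorem IsPeak.exists_add_eq (hp : IsPeak f r l S p) (h : QuadModel f G H δ R) (hr : r ≤ R)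
    (hδ : 0 ≤ δ) (hH : SaddleForm H N m c C) (hδc : 2 * δ < c)
    (hm : Module.finrank ℝ S.direction = m) :
    ∃ v ∈ S.direction, ∃ w ∈ Nᗮ, v + w = p := by
  refine exists_add_eq_of_disjoint ?_ ?_ p
  · rw [Submodule.disjoint_def]
    intro v hv hv'
    have h1 := hp.inner_hessian_le h hr hδ hv
    have h2 := hH.pos v hv'
    by_contra h0
    have h3 : 0 < ‖v‖ ^ 2 := by positivity
    nlinarith
  · have h2 := N.finrank_add_finrank_orthogonal
    rw [hH.finrank_eq] at h2
    simp at h2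
    omega

theorem SaddleForm.inner_sub_self (hH : SaddleForm H N m c C) (p v : RSpace n) :
    inner ℝ (H (p - v)) (p - v) = inner ℝ (H p) p - 2 * inner ℝ (H p) v + inner ℝ (H v) v := by
  have := hH.symm v p
  rw [map_sub, inner_sub_left, inner_sub_right, inner_sub_right, this, real_inner_comm (H p) v]
  ring

theorem SaddleForm.inner_add_self (hH : SaddleForm H N m c C) (p v : RSpace n) :
    inner ℝ (H (p + v)) (p + v) = inner ℝ (H p) p + 2 * inner ℝ (H p) v + inner ℝ (H v) v := by
  have := hH.symm v p
  rw [map_add, inner_add_left, inner_add_right, inner_add_right, this, real_inner_comm (H p) v]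
  ring

/-- If `f ≤ 0` on an admissible plane, then the plane meets `Nᗮ` within the slice. -/
theorem IsPeak.exists_mem_orthogonal (hp : IsPeak f r l S p) (h : QuadModel f G H δ R)
    (hr : r ≤ R) (hδ : 0 ≤ δ) (hH : SaddleForm H N m c C) (hδc : 16 * δ ≤ c) (hl : l ≤ 0)
    (hm : Module.finrank ℝ S.direction = m) (hfp : f p ≤ 0) :
    ∃ w ∈ slice f (Metric.ball 0 r) l S, c / 4 * ‖w‖ ^ 2 ≤ f w := by
  have hc := hH.c_pos
  obtain ⟨v, hv, w, hw, rfl⟩ := hp.exists_add_eq h hr hδ hH (by linarith) hm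
  set p := v + w with hpdef
  have hwp : w = p - v := by simp [hpdef]
  have hpR := hp.norm_lt.trans_le hr
  have h1 := (abs_le.1 (h.abs_sub_le hpR hδ)).1
  have h2 := (abs_le.1 (h.abs_inner_le_of_inner_grad_eq_zero hpR (hp.inner_grad_eq_zero h hv))).1
  have h3 := hp.inner_hessian_le h hr hδ hv
  have h4 := hH.pos w hw
  have h5 := hH.inner_sub_self p v
  rw [← hwp] at h5
  have hvn : ‖v‖ ≤ ‖p‖ + ‖w‖ := by
    have : v = p - w := by simp [hpdef]
    rw [this]; exact norm_sub_le _ _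
  have hle : ‖w‖ ≤ ‖p‖ := by
    by_contra hlt
    push Not at hlt
    have a1 : ‖v‖ ≤ 2 * ‖w‖ := by linarith
    have a2 : c * ‖w‖ ^ 2 ≤ δ * (2 * ‖p‖ ^ 2 + 2 * (‖p‖ * ‖v‖) + 2 * ‖v‖ ^ 2) := by nlinarith
    have a3 : ‖p‖ ^ 2 < ‖w‖ ^ 2 := by gcongr
    have a4 : ‖p‖ * ‖v‖ ≤ ‖w‖ * (2 * ‖w‖) := by gcongr
    have a5 : ‖v‖ ^ 2 ≤ (2 * ‖w‖) ^ 2 := by gcongr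
    have a6 : 0 < ‖w‖ ^ 2 := lt_of_le_of_lt (sq_nonneg _) a3
    have a7 : δ * (2 * ‖p‖ ^ 2 + 2 * (‖p‖ * ‖v‖) + 2 * ‖v‖ ^ 2) ≤ δ * (14 * ‖w‖ ^ 2) := by
      gcongr
      nlinarith
    nlinarith
  have hwr : ‖w‖ < r := hle.trans_lt hp.norm_lt
  have hfw : c / 4 * ‖w‖ ^ 2 ≤ f w := by
    have := (abs_le.1 (h.abs_sub_le (hwr.trans_le hr) hδ)).1
    nlinarith [sq_nonneg ‖w‖]
  have hwS : w ∈ S := by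
    have := add_smul_mem hp.1.1 hv (-1)
    rwa [hpdef, neg_one_smul, add_comm v w, add_neg_cancel_right] at this
  exact ⟨w, ⟨hwS, hl.trans ((by positivity : (0:ℝ) ≤ c / 4 * ‖w‖ ^ 2).trans hfw),
    by simpa using hwr⟩, hfw⟩

theorem IsPeak.nonneg (hp : IsPeak f r l S p) (h : QuadModel f G H δ R)
    (hr : r ≤ R) (hδ : 0 ≤ δ) (hH : SaddleForm H N m c C) (hδc : 16 * δ ≤ c) (hl : l ≤ 0)
    (hm : Module.finrank ℝ S.direction = m) : 0 ≤ f p := by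
  by_contra hlt
  push Not at hlt
  obtain ⟨w, hw, hfw⟩ := hp.exists_mem_orthogonal h hr hδ hH hδc hl hm hlt.le
  have h1 := hp.2 w hw.1 (by simpa using hw.2.2)
  have hc := hH.c_pos
  have : 0 ≤ c / 4 * ‖w‖ ^ 2 := by positivity
  linarith

theorem QuadModel.le_neg_of_mem (h : QuadModel f G H δ R) (hδ : 0 ≤ δ)
    (hH : SaddleForm H N m c C) (hδc : 4 * δ ≤ c) {v : RSpace n} (hv : v ∈ N) (hvR : ‖v‖ < R) :
    f v ≤ -(c / 4 * ‖v‖ ^ 2) := by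
  have h1 := (abs_le.1 (h.abs_sub_le hvR hδ)).2
  have h2 := hH.neg v hv
  nlinarith [sq_nonneg ‖v‖]

theorem dist_le_diam_slice {x y : RSpace n} (hx : x ∈ slice f (Metric.ball 0 r) l S)
    (hy : y ∈ slice f (Metric.ball 0 r) l S) :
    dist x y ≤ Metric.diam (slice f (Metric.ball 0 r) l S) :=
  Metric.dist_le_diam_of_mem (Metric.isBounded_ball.subset fun _ h => h.2.2) hx hy

theorem mem_slice_toAffineSubspace {q : RSpace n}
    (hq : q ∈ slice f (Metric.ball 0 r) l N.toAffineSubspace) : q ∈ N := hq.1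

theorem norm_sq_le_of_mem_slice (h : QuadModel f G H δ R) (hr : r ≤ R)
    (hδ : 0 ≤ δ) (hH : SaddleForm H N m c C) (hδc : 16 * δ ≤ c) {q : RSpace n}
    (hq : q ∈ slice f (Metric.ball 0 r) l N.toAffineSubspace) : ‖q‖ ^ 2 ≤ 4 * |l| / c := by
  have hc := hH.c_pos
  have hqr : ‖q‖ < r := by simpa using hq.2.2
  have h1 := h.le_neg_of_mem hδ hH (by linarith) (mem_slice_toAffineSubspace hq) (hqr.trans_le hr)
  have h2 := hq.2.1
  rw [le_div_iff₀ hc]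
  have := neg_le_abs l
  linarith

theorem admissible_negative (h : QuadModel f G H δ R) (hr : r ≤ R) (hr0 : 0 < r)
    (hδ : 0 ≤ δ) (hH : SaddleForm H N m c C) (hδc : 16 * δ ≤ c) (hl : l ≤ 0)
    (hlr : 16 * |l| < c * r ^ 2) :
    Admissible f m (Metric.ball 0 r) l N.toAffineSubspace := by
  have hc := hH.c_pos
  refine ⟨by rw [Submodule.toAffineSubspace_direction]; exact hH.finrank_eq,
    ⟨0, N.zero_mem, by rw [h.map_zero]; exact hl, by simpa using hr0⟩, ?_⟩
  have : slice f (Metric.ball 0 r) l N.toAffineSubspace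
      = (N : Set (RSpace n)) ∩ {q | l ≤ f q} ∩ Metric.closedBall 0 (r / 2) := by
    ext q
    constructor
    · intro hq
      refine ⟨⟨mem_slice_toAffineSubspace hq, hq.2.1⟩, ?_⟩
      have h1 := norm_sq_le_of_mem_slice h hr hδ hH hδc hq
      rw [mem_closedBall_zero_iff]
      refine (sq_le_sq₀ (norm_nonneg _) (by positivity)).1 (h1.trans ?_)
      rw [div_le_iff₀ hc]
      linarith
    · intro hq
      refine ⟨hq.1.1, hq.1.2, ?_⟩
      have := hq.2
      rw [mem_closedBall_zero_iff] at this
      rw [mem_ball_zero_iff]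
      linarith
  rw [this]
  exact ((Submodule.closed_of_finiteDimensional N).inter
    (isClosed_le continuous_const h.continuous)).inter Metric.isClosed_closedBall

theorem IsOptimizingTriple.diam_sq_le {x y : RSpace n}
    (ht : IsOptimizingTriple f m (Metric.ball 0 r) l S x y)
    (h : QuadModel f G H δ R) (hr : r ≤ R) (hr0 : 0 < r)
    (hδ : 0 ≤ δ) (hH : SaddleForm H N m c C) (hδc : 16 * δ ≤ c) (hl : l ≤ 0)
    (hlr : 16 * |l| < c * r ^ 2) :
    Metric.diam (slice f (Metric.ball 0 r) l S) ^ 2 ≤ 16 * |l| / c := by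
  have hc := hH.c_pos
  have h1 := ht.2.2.2.2 _ (admissible_negative h hr hr0 hδ hH hδc hl hlr)
  have h2 : Metric.diam (slice f (Metric.ball 0 r) l N.toAffineSubspace)
      ≤ 2 * √(4 * |l| / c) := by
    refine Metric.diam_le_of_forall_dist_le (by positivity) fun a ha b hb => ?_
    have h3 := Real.le_sqrt_of_sq_le (norm_sq_le_of_mem_slice h hr hδ hH hδc ha)
    have h4 := Real.le_sqrt_of_sq_le (norm_sq_le_of_mem_slice h hr hδ hH hδc hb)
    rw [dist_eq_norm]
    linarith [norm_sub_le a b]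
  calc _ ≤ (2 * √(4 * |l| / c)) ^ 2 := pow_le_pow_left₀ Metric.diam_nonneg (h1.trans h2) 2
    _ = _ := by rw [mul_pow, Real.sq_sqrt (by positivity)]; ring

end Slices

/-- An optimizing triple at a negative level that is small compared with the radius `r`, which in
turn is so small that `f` is close to its quadratic part. -/
structure OptimalSetting (f : RSpace n → ℝ) (G : RSpace n → RSpace n)
    (H : RSpace n →L[ℝ] RSpace n) (N : Submodule ℝ (RSpace n)) (m : ℕ) (c C δ R r l : ℝ)
    (S : AffineSubspace ℝ (RSpace n)) (x y : RSpace n) : Prop where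
  model : QuadModel f G H δ R
  form : SaddleForm H N m c C
  one_le : 1 ≤ m
  r_pos : 0 < r
  r_lt : r < R
  δ_nonneg : 0 ≤ δ
  δ_le : 256 * δ ≤ c
  level_neg : l < 0
  level_small : 6144 * C * |l| < c ^ 2 * r ^ 2
  triple : IsUniqueOptimizingTriple f m (Metric.ball 0 r) l S x y

namespace OptimalSetting

variable {f : RSpace n → ℝ} {G : RSpace n → RSpace n} {H : RSpace n →L[ℝ] RSpace n}
  {N : Submodule ℝ (RSpace n)} {m : ℕ} {c C δ R r l : ℝ} {S : AffineSubspace ℝ (RSpace n)}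
  {x y p : RSpace n}

theorem symm (h : OptimalSetting f G H N m c C δ R r l S x y) :
    OptimalSetting f G H N m c C δ R r l S y x := by
  obtain ⟨⟨h1, h2, h3, h4, h5⟩, h6, h7, h8, h9⟩ := h.triple
  refine { h with triple := ⟨⟨h1, h3, h2, by rwa [dist_comm], h5⟩, h7, h6, by rwa [dist_comm],
    fun x' hx' y' hy' hd => ?_⟩ }
  rcases h9 x' hx' y' hy' hd with h | h
  · exact Or.inr h
  · exact Or.inl h

theorem admissible (h : OptimalSetting f G H N m c C δ R r l S x y) :
    Admissible f m (Metric.ball 0 r) l S := h.triple.1.1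

theorem exists_isPeak (h : OptimalSetting f G H N m c C δ R r l S x y) :
    ∃ p, IsPeak f r l S p := h.admissible.exists_isPeak h.model.continuous

theorem peak_nonneg (h : OptimalSetting f G H N m c C δ R r l S x y) (hp : IsPeak f r l S p) :
    0 ≤ f p :=
  hp.nonneg h.model h.r_lt.le h.δ_nonneg h.form (by linarith [h.δ_le, h.δ_nonneg]) h.level_neg.le
    h.admissible.1

theorem abs_level (h : OptimalSetting f G H N m c C δ R r l S x y) : |l| = -l :=
  abs_of_neg h.level_neg

theorem dist_sq_le (h : OptimalSetting f G H N m c C δ R r l S x y) :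
    dist x y ^ 2 ≤ 16 * |l| / c := by
  have hc := h.form.c_pos
  rw [h.triple.1.2.2.2.1]
  refine h.triple.1.diam_sq_le h.model h.r_lt.le h.r_pos h.δ_nonneg h.form
    (by linarith [h.δ_le, h.δ_nonneg]) h.level_neg.le ?_
  have h1 := h.level_small
  have h2 : c * (6144 * |l|) ≤ 6144 * C * |l| := by
    nlinarith [h.form.c_le, abs_nonneg l]
  have h3 : c * (6144 * |l|) < c * (c * r ^ 2) := by
    calc _ ≤ _ := h2
      _ < _ := h1
      _ = _ := by ring
  have h4 := lt_of_mul_lt_mul_left h3 hc.le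
  linarith [abs_nonneg l]

/-- Every line through the peak in the plane leaves the slice at a point of level `l`. -/
theorem exists_level_point (h : OptimalSetting f G H N m c C δ R r l S x y)
    (hp : IsPeak f r l S p) {v : RSpace n} (hv : v ∈ S.direction) (hv1 : ‖v‖ = 1) :
    ∃ t : ℝ, t ^ 2 ≤ dist x y ^ 2 ∧ ‖p + t • v‖ < r ∧ f (p + t • v) = l := by
  have hK := isCompact_slice h.admissible
  set K := slice f (Metric.ball 0 r) l S with hKdef
  have hcont : Continuous fun t : ℝ => p + t • v := by fun_prop
  have hT : ∀ t ∈ (fun t : ℝ => p + t • v) ⁻¹' K, |t| ≤ dist x y := by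
    intro t ht
    have := dist_le_diam_slice hp.1 ht
    rw [← hKdef, ← h.triple.1.2.2.2.1, dist_eq_norm, sub_add_cancel_left, norm_neg, norm_smul, hv1,
      mul_one] at this
    exact this
  have hTc : IsCompact ((fun t : ℝ => p + t • v) ⁻¹' K) := by
    refine Metric.isCompact_of_isClosed_isBounded (hK.isClosed.preimage hcont) ?_
    refine (Metric.isBounded_closedBall (x := (0 : ℝ)) (r := dist x y)).subset fun t ht => ?_
    rw [mem_closedBall_zero_iff, Real.norm_eq_abs]
    exact hT t ht
  obtain ⟨t, ht, hmax⟩ := hTc.exists_isGreatest ⟨0, by simpa using hp.1⟩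
  have htr : ‖p + t • v‖ < r := by simpa using ht.2.2
  refine ⟨t, sq_le_sq' (neg_le_of_abs_le (hT t ht)) (le_of_abs_le (hT t ht)), htr, ?_⟩
  refine le_antisymm ?_ ht.2.1
  by_contra hlt
  push Not at hlt
  have hcf : ContinuousAt (fun s : ℝ => f (p + s • v)) t :=
    (h.model.continuous.comp hcont).continuousAt
  have hcn : ContinuousAt (fun s : ℝ => ‖p + s • v‖) t := hcont.norm.continuousAt
  have h1 : ∀ᶠ s in 𝓝[>] t, l < f (p + s • v) ∧ ‖p + s • v‖ < r :=
    ((hcf.eventually_const_lt hlt).and (hcn.eventually_lt_const htr)).filter_mono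
      nhdsWithin_le_nhds
  obtain ⟨s, ⟨hs1, hs2⟩, hs⟩ := (h1.and self_mem_nhdsWithin).exists
  have := hmax (show s ∈ (fun t : ℝ => p + t • v) ⁻¹' K from
    ⟨add_smul_mem hp.1.1 hv s, hs1.le, by simpa using hs2⟩)
  exact absurd this (not_le.2 hs)

theorem taylor_line (h : OptimalSetting f G H N m c C δ R r l S x y)
    (hp : IsPeak f r l S p) {v : RSpace n} (hv : v ∈ S.direction) {t : ℝ}
    (ht : ‖p + t • v‖ < R) :
    |f (p + t • v) - f p - t ^ 2 * inner ℝ (H v) v / 2| ≤ δ * (t ^ 2 * ‖v‖ ^ 2) := by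
  have h1 := h.model.taylor (hp.norm_lt.trans h.r_lt) ht h.δ_nonneg
  simp only [add_sub_cancel_left, inner_smul_right, hp.inner_grad_eq_zero h.model hv, map_smul,
    inner_smul_left, norm_smul, mul_pow, Real.norm_eq_abs, sq_abs, RCLike.conj_to_real] at h1
  convert h1 using 2
  ring

theorem inner_hessian_le_of_norm_eq_one (h : OptimalSetting f G H N m c C δ R r l S x y)
    (hp : IsPeak f r l S p) {v : RSpace n} (hv : v ∈ S.direction) (hv1 : ‖v‖ = 1) :
    inner ℝ (H v) v ≤ -(c / 16) ∧ f p + |l| ≤ C * dist x y ^ 2 := by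
  have hc := h.form.c_pos
  have hpn := h.peak_nonneg hp
  have hln := h.level_neg
  obtain ⟨t, htD, htr, htl⟩ := h.exists_level_point hp hv hv1
  have h1 := h.taylor_line hp hv (htr.trans h.r_lt)
  rw [htl, hv1, one_pow, mul_one] at h1
  have h2 := (abs_le.1 h1).1
  have h3 := h.form.abs_inner_le v v
  rw [hv1, mul_one, mul_one] at h3
  have h4 := h.dist_sq_le
  rw [le_div_iff₀ hc] at h4
  have h5 := h.δ_le
  have h6 := h.abs_level
  have ht0 : 0 < t ^ 2 := by
    rcases (sq_nonneg t).eq_or_lt with h0 | h0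
    · have : t = 0 := by simpa using h0.symm
      rw [this] at htl
      simp at htl
      linarith
    · exact h0
  have h7 := (abs_le.1 h3).1
  have h8 : t ^ 2 * (c / 16) ≤ |l| := by nlinarith
  constructor
  · refine le_of_mul_le_mul_left ?_ ht0
    nlinarith
  · have hC := h.form.c_le
    have : f p + |l| ≤ C * t ^ 2 := by nlinarith
    exact this.trans (by gcongr; linarith)

theorem inner_hessian_le (h : OptimalSetting f G H N m c C δ R r l S x y)
    {v : RSpace n} (hv : v ∈ S.direction) : inner ℝ (H v) v ≤ -(c / 16) * ‖v‖ ^ 2 := by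
  obtain ⟨p, hp⟩ := h.exists_isPeak
  rcases eq_or_ne v 0 with rfl | hv0
  · simp
  have hv1 : 0 < ‖v‖ := norm_pos_iff.2 hv0
  have h1 := (h.inner_hessian_le_of_norm_eq_one hp (S.direction.smul_mem ‖v‖⁻¹ hv)
    (by rw [norm_smul, norm_inv, norm_norm, inv_mul_cancel₀ hv1.ne'])).1
  rw [map_smul, inner_smul_left, inner_smul_right] at h1
  simp only [RCLike.conj_to_real] at h1
  have h2 : inner ℝ (H v) v = (‖v‖⁻¹ * (‖v‖⁻¹ * inner ℝ (H v) v)) * ‖v‖ ^ 2 := by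
    field_simp
  rw [h2]
  gcongr

theorem peak_add_le (h : OptimalSetting f G H N m c C δ R r l S x y) (hp : IsPeak f r l S p) :
    f p + |l| ≤ C * dist x y ^ 2 := by
  have hm : 0 < Module.finrank ℝ S.direction := by
    rw [h.admissible.1]; exact h.one_le
  have := Module.finrank_pos_iff.1 hm
  obtain ⟨v, hv⟩ := exists_norm_eq S.direction (zero_le_one (α := ℝ))
  exact (h.inner_hessian_le_of_norm_eq_one hp v.2 hv).2

theorem level_le (h : OptimalSetting f G H N m c C δ R r l S x y) : |l| ≤ C * dist x y ^ 2 := by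
  obtain ⟨p, hp⟩ := h.exists_isPeak
  linarith [h.peak_add_le hp, h.peak_nonneg hp]

theorem ne (h : OptimalSetting f G H N m c C δ R r l S x y) : x ≠ y := by
  rintro rfl
  have := h.level_le
  simp at this
  exact h.level_neg.ne this

theorem peak_add_le' (h : OptimalSetting f G H N m c C δ R r l S x y) (hp : IsPeak f r l S p) :
    f p + |l| ≤ 16 * C * |l| / c := by
  have hc := h.form.c_pos
  have h1 := h.peak_add_le hp
  have h2 : C * dist x y ^ 2 ≤ C * (16 * |l| / c) := by
    have := h.form.c_le
    gcongr
    · linarith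
    · exact h.dist_sq_le
  calc _ ≤ _ := h1.trans h2
    _ = _ := by ring

theorem peak_norm_sq_le (h : OptimalSetting f G H N m c C δ R r l S x y)
    (hp : IsPeak f r l S p) : c * ‖p‖ ^ 2 ≤ 128 * f p := by
  have hc := h.form.c_pos
  have hδ := h.δ_nonneg
  have hδc := h.δ_le
  obtain ⟨v, hv, w, hw, hvw⟩ := hp.exists_add_eq h.model h.r_lt.le hδ h.form (by linarith)
    h.admissible.1
  have hwp : w = p - v := by simp [← hvw]
  have hpR := hp.norm_lt.trans h.r_lt
  have h1 := (abs_le.1 (h.model.abs_sub_le hpR hδ)).1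
  have h2 := (abs_le.1 (h.model.abs_inner_le_of_inner_grad_eq_zero hpR
    (hp.inner_grad_eq_zero h.model hv))).1
  have h3 := h.inner_hessian_le hv
  have h4 := h.form.pos w hw
  have h5 := h.form.inner_sub_self p v
  rw [← hwp] at h5
  have h6 : ‖p‖ ≤ ‖v‖ + ‖w‖ := by rw [← hvw]; exact norm_add_le _ _
  have h7 : ‖p‖ ^ 2 ≤ 2 * (‖v‖ ^ 2 + ‖w‖ ^ 2) := by
    nlinarith [sq_nonneg (‖v‖ - ‖w‖), norm_nonneg p]
  have h8 : ‖p‖ * ‖v‖ ≤ 3 / 2 * (‖v‖ ^ 2 + ‖w‖ ^ 2) := by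
    nlinarith [sq_nonneg (‖p‖ - ‖v‖), sq_nonneg ‖w‖]
  set Q := ‖v‖ ^ 2 + ‖w‖ ^ 2 with hQ
  have hQ0 : 0 ≤ Q := by positivity
  have h9 : c / 16 * Q ≤ 2 * f p + 7 * (δ * Q) := by
    have e1 : c / 16 * ‖w‖ ^ 2 ≤ c * ‖w‖ ^ 2 := by nlinarith [sq_nonneg ‖w‖]
    have e2 : δ * ‖p‖ ^ 2 ≤ δ * (2 * Q) := by gcongr
    have e3 : δ * (‖p‖ * ‖v‖) ≤ δ * (3 / 2 * Q) := by gcongr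
    nlinarith
  nlinarith

/-- In the closed ball, the function restricted to the plane lies below its tangents. -/
theorem le_tangent (h : OptimalSetting f G H N m c C δ R r l S x y) {a b : RSpace n}
    (ha : ‖a‖ ≤ r) (hb : ‖b‖ ≤ r) (hab : b - a ∈ S.direction) :
    f b ≤ f a + inner ℝ (G a) (b - a) - c / 64 * ‖b - a‖ ^ 2 := by
  have h1 := (abs_le.1 (h.model.taylor (ha.trans_lt h.r_lt) (hb.trans_lt h.r_lt) h.δ_nonneg)).2
  have h2 := h.inner_hessian_le hab
  have := h.δ_le
  have := h.form.c_pos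
  nlinarith [sq_nonneg ‖b - a‖]

/-- The part of the superlevel set that lies in the plane and in the closed ball is close to the
origin. -/
theorem norm_sq_le (h : OptimalSetting f G H N m c C δ R r l S x y) {q : RSpace n}
    (hq : q ∈ S) (hqr : ‖q‖ ≤ r) (hlq : l ≤ f q) : c ^ 2 * ‖q‖ ^ 2 ≤ 6144 * C * |l| := by
  have hc := h.form.c_pos
  obtain ⟨p, hp⟩ := h.exists_isPeak
  have hdir : q - p ∈ S.direction := AffineSubspace.vsub_mem_direction hq hp.1.1
  have h1 := h.le_tangent hp.norm_lt.le hqr hdir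
  rw [hp.inner_grad_eq_zero h.model hdir] at h1
  have h2 := h.peak_norm_sq_le hp
  have h3 := h.peak_add_le' hp
  rw [le_div_iff₀ hc] at h3
  have h4 := h.abs_level
  have h5 : ‖q‖ ≤ ‖q - p‖ + ‖p‖ := by
    have := norm_add_le (q - p) p
    rwa [sub_add_cancel] at this
  have h6 : ‖q‖ ^ 2 ≤ 2 * ‖q - p‖ ^ 2 + 2 * ‖p‖ ^ 2 := by
    nlinarith [sq_nonneg (‖q - p‖ - ‖p‖), norm_nonneg q]
  have h7 : c * ‖q - p‖ ^ 2 ≤ 64 * (f p + |l|) := by linarith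
  have h8 : c * ‖q‖ ^ 2 ≤ 384 * (f p + |l|) := by
    have : 0 ≤ |l| := abs_nonneg l
    nlinarith
  nlinarith

theorem norm_lt (h : OptimalSetting f G H N m c C δ R r l S x y) {q : RSpace n}
    (hq : q ∈ S) (hqr : ‖q‖ ≤ r) (hlq : l ≤ f q) : ‖q‖ < r := by
  have hc := h.form.c_pos
  have h1 := (h.norm_sq_le hq hqr hlq).trans_lt h.level_small
  have h2 := lt_of_mul_lt_mul_left h1 (by positivity)
  exact lt_of_pow_lt_pow_left₀ 2 h.r_pos.le h2

theorem mem_left (h : OptimalSetting f G H N m c C δ R r l S x y) :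
    x ∈ slice f (Metric.ball 0 r) l S := h.triple.1.2.1

theorem norm_left_lt (h : OptimalSetting f G H N m c C δ R r l S x y) : ‖x‖ < r := by
  simpa using h.mem_left.2.2

theorem norm_left_sq_le (h : OptimalSetting f G H N m c C δ R r l S x y) :
    c ^ 2 * ‖x‖ ^ 2 ≤ 6144 * C * |l| :=
  h.norm_sq_le h.mem_left.1 h.norm_left_lt.le h.mem_left.2.1

theorem map_left (h : OptimalSetting f G H N m c C δ R r l S x y) : f x = l := by
  refine le_antisymm ?_ h.mem_left.2.1
  by_contra hlt
  push Not at hlt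
  have hdir : x - y ∈ S.direction :=
    AffineSubspace.vsub_mem_direction h.mem_left.1 h.symm.mem_left.1
  have hcf : ContinuousAt (fun s : ℝ => f (x + s • (x - y))) 0 :=
    (h.model.continuous.comp (by fun_prop)).continuousAt
  have h1 : ∀ᶠ s : ℝ in 𝓝[>] 0, l < f (x + s • (x - y)) ∧ ‖x + s • (x - y)‖ < r :=
    ((hcf.eventually_const_lt (by simpa using hlt)).and
      (eventually_norm_add_smul_lt _ h.norm_left_lt)).filter_mono nhdsWithin_le_nhds
  obtain ⟨s, ⟨hs1, hs2⟩, hs⟩ := (h1.and self_mem_nhdsWithin).exists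
  have h2 := dist_le_diam_slice (⟨add_smul_mem h.mem_left.1 hdir s, hs1.le, by simpa using hs2⟩ :
    x + s • (x - y) ∈ slice f (Metric.ball 0 r) l S) h.symm.mem_left
  rw [← h.triple.1.2.2.2.1, dist_eq_norm, dist_eq_norm] at h2
  have h3 : x + s • (x - y) - y = (1 + s) • (x - y) := by module
  have hs' : (0 : ℝ) < s := hs
  have h4 : 0 < ‖x - y‖ := norm_pos_iff.2 (sub_ne_zero.2 h.ne)
  rw [h3, norm_smul, Real.norm_of_nonneg (by linarith)] at h2
  nlinarith

end OptimalSetting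

/-- At level zero the slice of an optimal plane reduces to the critical point. -/
theorem eq_zero_of_level_zero {f : RSpace n → ℝ} {G : RSpace n → RSpace n}
    {H : RSpace n →L[ℝ] RSpace n} {N : Submodule ℝ (RSpace n)} {m : ℕ} {c C δ R r : ℝ}
    {S : AffineSubspace ℝ (RSpace n)} {x y : RSpace n}
    (h : QuadModel f G H δ R) (hr : r ≤ R) (hr0 : 0 < r) (hδ : 0 ≤ δ)
    (hH : SaddleForm H N m c C) (hδc : 16 * δ ≤ c) (hm : 1 ≤ m)
    (ht : IsOptimizingTriple f m (Metric.ball 0 r) 0 S x y) : x = 0 ∧ y = 0 := by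
  have hc := hH.c_pos
  have hd := ht.diam_sq_le h hr hr0 hδ hH hδc le_rfl (by simp; positivity)
  simp only [abs_zero, mul_zero, zero_div] at hd
  have hd0 : Metric.diam (slice f (Metric.ball 0 r) 0 S) = 0 := by
    have := Metric.diam_nonneg (s := slice f (Metric.ball 0 r) 0 S)
    nlinarith
  have hall : ∀ a ∈ slice f (Metric.ball 0 r) 0 S, ∀ b ∈ slice f (Metric.ball 0 r) 0 S,
      a = b := fun a ha b hb =>
    dist_le_zero.1 ((dist_le_diam_slice ha hb).trans hd0.le)
  obtain ⟨p, hp⟩ := ht.1.exists_isPeak h.continuous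
  have hfp : f p ≤ 0 := by
    by_contra hlt
    push Not at hlt
    have hm : 0 < Module.finrank ℝ S.direction := by
      rw [ht.1.1]; exact hm
    have := Module.finrank_pos_iff.1 hm
    obtain ⟨⟨v, hv⟩, hv1⟩ := exists_norm_eq S.direction (zero_le_one (α := ℝ))
    have hcf : ContinuousAt (fun s : ℝ => f (p + s • v)) 0 :=
      (h.continuous.comp (by fun_prop)).continuousAt
    have h1 : ∀ᶠ s : ℝ in 𝓝[>] 0, 0 < f (p + s • v) ∧ ‖p + s • v‖ < r :=
      ((hcf.eventually_const_lt (by simpa using hlt)).and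
        (eventually_norm_add_smul_lt _ hp.norm_lt)).filter_mono nhdsWithin_le_nhds
    obtain ⟨s, ⟨hs1, hs2⟩, hs⟩ := (h1.and self_mem_nhdsWithin).exists
    have h2 := hall _ ⟨add_smul_mem hp.1.1 hv s, hs1.le, by simpa using hs2⟩ _ hp.1
    have hs' : (0 : ℝ) < s := hs
    rw [add_eq_left, smul_eq_zero] at h2
    rcases h2 with h2 | h2
    · exact hs'.ne' h2
    · have hv1' : ‖v‖ = 1 := hv1
      rw [h2] at hv1'
      simp at hv1'
  obtain ⟨w, hw, hfw⟩ := hp.exists_mem_orthogonal h hr hδ hH hδc le_rfl ht.1.1 hfp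
  have hwp := hall w hw p hp.1
  have hp0 : p = 0 := by
    rw [hwp] at hfw
    have : ‖p‖ ^ 2 ≤ 0 := by
      refine le_of_mul_le_mul_left ?_ (by positivity : 0 < c / 4)
      linarith
    have h3 : ‖p‖ = 0 := by nlinarith [norm_nonneg p]
    exact norm_eq_zero.1 h3
  exact ⟨(hall x ht.2.1 p hp.1).trans hp0, (hall y ht.2.2.1 p hp.1).trans hp0⟩

/-- The transvection `v ↦ v - (t ⟪d, v⟫) u`. -/
noncomputable def shear (d u : RSpace n) (t : ℝ) : RSpace n →ₗ[ℝ] RSpace n :=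
  LinearMap.id - (t • (innerₛₗ ℝ d)).smulRight u

theorem shear_apply (d u : RSpace n) (t : ℝ) (v : RSpace n) :
    shear d u t v = v - (t * inner ℝ d v) • u := by
  simp [shear]

theorem shear_shear {d u : RSpace n} (hdu : inner ℝ d u = 0) (t : ℝ) (v : RSpace n) :
    shear d u t v + (t * inner ℝ d (shear d u t v)) • u = v := by
  rw [shear_apply, inner_sub_right, inner_smul_right, hdu]
  module

theorem shear_injective {d u : RSpace n} (hdu : inner ℝ d u = 0) (t : ℝ) :
    Function.Injective (shear d u t) := fun v w hvw => by
  rw [← shear_shear hdu t v, ← shear_shear hdu t w, hvw]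

namespace OptimalSetting

variable {f : RSpace n → ℝ} {G : RSpace n → RSpace n} {H : RSpace n →L[ℝ] RSpace n}
  {N : Submodule ℝ (RSpace n)} {m : ℕ} {c C δ R r l : ℝ} {S : AffineSubspace ℝ (RSpace n)}
  {x y p u : RSpace n}

theorem eventually_le_of_tendsto (h : QuadModel f G H δ R) (hr : r ≤ R) (hδ : 0 ≤ δ)
    {Z w : ℕ → RSpace n} {t : ℕ → ℝ} {z w₀ : RSpace n} (hZ : Tendsto Z atTop (𝓝 z))
    (hz : ‖z‖ < r) (hw : Tendsto w atTop (𝓝 w₀)) (ht : Tendsto t atTop (𝓝 0))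
    (ht0 : ∀ k, 0 < t k) (hl : ∀ k, l ≤ f (Z k)) (hpos : 0 < inner ℝ (G z) w₀) :
    ∀ᶠ k in atTop, l ≤ f (Z k + t k • w k) ∧ Z k + t k • w k ∈ Metric.ball 0 r := by
  have h1 : Tendsto (fun k => Z k + t k • w k) atTop (𝓝 z) := by
    simpa using hZ.add (ht.smul hw)
  have h2 : Tendsto (fun k => inner ℝ (G (Z k)) (w k)
      + t k * (inner ℝ (H (w k)) (w k) / 2 - δ * ‖w k‖ ^ 2)) atTop (𝓝 (inner ℝ (G z) w₀)) := by
    have e1 : Tendsto (fun k => G (Z k)) atTop (𝓝 (G z)) := (h.grad_continuous.tendsto z).comp hZ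
    have e2 : Tendsto (fun k => H (w k)) atTop (𝓝 (H w₀)) := (H.continuous.tendsto w₀).comp hw
    have e3 := (e1.inner hw (𝕜 := ℝ)).add
      (ht.mul (((e2.inner hw (𝕜 := ℝ)).div_const 2).sub ((hw.norm.pow 2).const_mul δ)))
    simpa using e3
  filter_upwards [h1.norm.eventually_lt_const hz, hZ.norm.eventually_lt_const hz,
    h2.eventually_const_lt hpos] with k k1 k2 k3
  refine ⟨?_, by simpa using k1⟩
  have h3 := h.taylor (k2.trans_le hr) (k1.trans_le hr) hδ
  simp only [add_sub_cancel_left, inner_smul_right, map_smul, inner_smul_left, norm_smul, mul_pow,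
    Real.norm_eq_abs, sq_abs, RCLike.conj_to_real] at h3
  have h4 := (abs_le.1 h3).1
  have h5 := mul_pos (ht0 k) k3
  have := hl k
  nlinarith

/-- The plane `S` sheared in the direction `u`, with `y` fixed. -/
noncomputable def shearPlane (S : AffineSubspace ℝ (RSpace n)) (d u y : RSpace n) (t : ℝ) :
    AffineSubspace ℝ (RSpace n) :=
  AffineSubspace.mk' y (S.direction.map (shear d u t))

theorem mem_shearPlane_self (d u : RSpace n) (t : ℝ) : y ∈ shearPlane S d u y t :=
  AffineSubspace.self_mem_mk' _ _

theorem mem_direction_of_mem_shearPlane {d : RSpace n} (hdu : inner ℝ d u = 0) {t : ℝ}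
    {q : RSpace n} (hq : q ∈ shearPlane S d u y t) :
    q - y + (t * inner ℝ d (q - y)) • u ∈ S.direction := by
  rw [shearPlane, AffineSubspace.mem_mk', vsub_eq_sub] at hq
  obtain ⟨v, hv, hvq⟩ := hq
  rw [← hvq, shear_shear hdu]
  exact hv

theorem exists_subseq_tendsto (hf : Continuous f) {d : RSpace n} (hdu : inner ℝ d u = 0)
    (hy : y ∈ S) {t : ℕ → ℝ} (ht : Tendsto t atTop (𝓝 0)) {q : ℕ → RSpace n}
    (hq : ∀ k, q k ∈ shearPlane S d u y (t k)) (hqr : ∀ k, ‖q k‖ ≤ r) (hql : ∀ k, l ≤ f (q k)) :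
    ∃ q₀ ∈ S, ‖q₀‖ ≤ r ∧ l ≤ f q₀ ∧ ∃ ψ : ℕ → ℕ, StrictMono ψ ∧
      Tendsto (q ∘ ψ) atTop (𝓝 q₀) := by
  obtain ⟨q₀, hq₀, ψ, hψ, hlim⟩ := (isCompact_closedBall (0 : RSpace n) r).tendsto_subseq
    (x := q) (fun k => by simpa using hqr k)
  refine ⟨q₀, ?_, by simpa using hq₀, ?_, ψ, hψ, hlim⟩
  · have h1 : Tendsto (fun k => (q ∘ ψ) k - y + ((t ∘ ψ) k * inner ℝ d ((q ∘ ψ) k - y)) • u)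
        atTop (𝓝 (q₀ - y)) := by
      have e1 : Tendsto (fun k => (q ∘ ψ) k - y) atTop (𝓝 (q₀ - y)) := hlim.sub_const y
      have e2 := e1.add (((ht.comp hψ.tendsto_atTop).mul
        ((tendsto_const_nhds (x := d)).inner e1 (𝕜 := ℝ))).smul_const u)
      simpa using e2
    have h2 : q₀ - y ∈ S.direction :=
      (Submodule.closed_of_finiteDimensional S.direction).mem_of_tendsto h1
        (Eventually.of_forall fun k => mem_direction_of_mem_shearPlane hdu (hq (ψ k)))
    have := AffineSubspace.vadd_mem_of_mem_direction h2 hy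
    simpa using this
  · exact ge_of_tendsto ((hf.tendsto q₀).comp hlim) (Eventually.of_forall fun k => hql (ψ k))

theorem exists_forall_norm_lt (h : OptimalSetting f G H N m c C δ R r l S x y) {d : RSpace n}
    (hdu : inner ℝ d u = 0) : ∃ T > 0, ∀ t, 0 < t → t < T →
      ∀ q ∈ shearPlane S d u y t, ‖q‖ ≤ r → l ≤ f q → ‖q‖ < r := by
  by_contra! hcon
  choose! t ht0 htT q hq hqr hql hqn using
    fun k : ℕ => hcon (1 / ((k : ℝ) + 1)) (by positivity)
  have ht : Tendsto t atTop (𝓝 0) := squeeze_zero (fun k => (ht0 k).le) (fun k => (htT k).le)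
    tendsto_one_div_add_atTop_nhds_zero_nat
  obtain ⟨q₀, hq₀, hr₀, hl₀, ψ, hψ, hlim⟩ :=
    exists_subseq_tendsto h.model.continuous hdu h.symm.mem_left.1 ht hq hqr hql
  have h1 := h.norm_lt hq₀ hr₀ hl₀
  have h2 : r ≤ ‖q₀‖ := ge_of_tendsto hlim.norm (Eventually.of_forall fun k => hqn (ψ k))
  linarith

theorem admissible_shearPlane (h : OptimalSetting f G H N m c C δ R r l S x y) {d : RSpace n}
    (hdu : inner ℝ d u = 0) {t : ℝ}
    (ht : ∀ q ∈ shearPlane S d u y t, ‖q‖ ≤ r → l ≤ f q → ‖q‖ < r) :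
    Admissible f m (Metric.ball 0 r) l (shearPlane S d u y t) := by
  refine ⟨?_, ⟨y, mem_shearPlane_self d u t, h.symm.mem_left.2.1, h.symm.mem_left.2.2⟩, ?_⟩
  · rw [shearPlane, AffineSubspace.direction_mk', ← h.admissible.1]
    exact (Submodule.equivMapOfInjective _ (shear_injective hdu t) _).finrank_eq.symm
  · have : slice f (Metric.ball 0 r) l (shearPlane S d u y t)
        = (shearPlane S d u y t : Set (RSpace n)) ∩ {q | l ≤ f q} ∩ Metric.closedBall 0 r := by
      ext q
      constructor
      · intro hq
        exact ⟨⟨hq.1, hq.2.1⟩, Metric.ball_subset_closedBall hq.2.2⟩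
      · intro hq
        exact ⟨hq.1.1, hq.1.2, by simpa using ht q hq.1.1 (by simpa using hq.2) hq.1.2⟩
    rw [this]
    exact ((AffineSubspace.closed_of_finiteDimensional _).inter
      (isClosed_le continuous_const h.model.continuous)).inter Metric.isClosed_closedBall

theorem exists_dist_eq_diam {K : Set (RSpace n)} (hK : IsCompact K) (hne : K.Nonempty) :
    ∃ a ∈ K, ∃ b ∈ K, dist a b = Metric.diam K := by
  obtain ⟨q, hq, hmax⟩ := (hK.prod hK).exists_isMaxOn (hne.prod hne)
    (f := fun q : RSpace n × RSpace n => dist q.1 q.2) (by fun_prop)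
  refine ⟨q.1, hq.1, q.2, hq.2, le_antisymm (Metric.dist_le_diam_of_mem hK.isBounded hq.1 hq.2) ?_⟩
  exact Metric.diam_le_of_forall_dist_le dist_nonneg fun a ha b hb =>
    isMaxOn_iff.1 hmax (a, b) (Set.mk_mem_prod ha hb)

/-- Diameters of the slices of sheared planes are attained at pairs that converge to the unique
diameter-attaining pair of the optimal plane. -/
theorem exists_seq (h : OptimalSetting f G H N m c C δ R r l S x y) {d : RSpace n}
    (hdu : inner ℝ d u = 0) : ∃ (t : ℕ → ℝ) (X Y : ℕ → RSpace n), (∀ k, 0 < t k) ∧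
      Tendsto t atTop (𝓝 0) ∧ Tendsto X atTop (𝓝 x) ∧ Tendsto Y atTop (𝓝 y) ∧
      (∀ k, X k ∈ shearPlane S d u y (t k) ∧ l ≤ f (X k)) ∧
      (∀ k, Y k ∈ shearPlane S d u y (t k) ∧ l ≤ f (Y k)) ∧ ∀ k, dist x y ≤ dist (X k) (Y k) := by
  obtain ⟨T, hT, hTlt⟩ := h.exists_forall_norm_lt hdu
  have key : ∀ k : ℕ, ∃ (t : ℝ) (X Y : RSpace n), 0 < t ∧ t < 1 / ((k : ℝ) + 1) ∧
      X ∈ slice f (Metric.ball 0 r) l (shearPlane S d u y t) ∧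
      Y ∈ slice f (Metric.ball 0 r) l (shearPlane S d u y t) ∧ dist x y ≤ dist X Y := by
    intro k
    have hpos : (0 : ℝ) < min T (1 / ((k : ℝ) + 1)) := lt_min hT (by positivity)
    obtain ⟨t, ht0, ht1⟩ := exists_between hpos
    have hadm := h.admissible_shearPlane hdu (hTlt t ht0 (ht1.trans_le (min_le_left _ _)))
    obtain ⟨a, ha, b, hb, hab⟩ := exists_dist_eq_diam (isCompact_slice hadm) hadm.2.1
    refine ⟨t, a, b, ht0, ht1.trans_le (min_le_right _ _), ha, hb, ?_⟩
    rw [hab, h.triple.1.2.2.2.1]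
    exact h.triple.1.2.2.2.2 _ hadm
  choose t X Y ht0 ht1 hX hY hXY using key
  have ht : Tendsto t atTop (𝓝 0) := squeeze_zero (fun k => (ht0 k).le) (fun k => (ht1 k).le)
    tendsto_one_div_add_atTop_nhds_zero_nat
  have hnorm : ∀ {t : ℝ} {q : RSpace n},
      q ∈ slice f (Metric.ball 0 r) l (shearPlane S d u y t) → ‖q‖ ≤ r := fun hq => by
    simpa using Metric.ball_subset_closedBall hq.2.2
  obtain ⟨x', hx', hxr, hxl, ψ, hψ, hlimx⟩ := exists_subseq_tendsto h.model.continuous hdu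
    h.symm.mem_left.1 ht (fun k => (hX k).1) (fun k => hnorm (hX k)) (fun k => (hX k).2.1)
  obtain ⟨y', hy', hyr, hyl, χ, hχ, hlimy⟩ := exists_subseq_tendsto (q := Y ∘ ψ)
    h.model.continuous hdu h.symm.mem_left.1 (ht.comp hψ.tendsto_atTop) (fun k => (hY (ψ k)).1)
    (fun k => hnorm (hY (ψ k))) (fun k => (hY (ψ k)).2.1)
  have hlimx' : Tendsto (X ∘ ψ ∘ χ) atTop (𝓝 x') := hlimx.comp hχ.tendsto_atTop
  have hlimy' : Tendsto (Y ∘ ψ ∘ χ) atTop (𝓝 y') := hlimy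
  have htt : Tendsto (t ∘ ψ ∘ χ) atTop (𝓝 0) :=
    (ht.comp hψ.tendsto_atTop).comp hχ.tendsto_atTop
  have hx'K : x' ∈ slice f (Metric.ball 0 r) l S :=
    ⟨hx', hxl, by simpa using h.norm_lt hx' hxr hxl⟩
  have hy'K : y' ∈ slice f (Metric.ball 0 r) l S :=
    ⟨hy', hyl, by simpa using h.norm_lt hy' hyr hyl⟩
  have hle : dist x y ≤ dist x' y' :=
    ge_of_tendsto (hlimx'.dist hlimy') (Eventually.of_forall fun k => hXY _)
  have heq : dist x' y' = Metric.diam (slice f (Metric.ball 0 r) l S) :=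
    le_antisymm (dist_le_diam_slice hx'K hy'K) (h.triple.1.2.2.2.1 ▸ hle)
  rcases h.triple.2.2.2.2 x' hx'K y' hy'K heq with ⟨rfl, rfl⟩ | ⟨rfl, rfl⟩
  · exact ⟨t ∘ ψ ∘ χ, X ∘ ψ ∘ χ, Y ∘ ψ ∘ χ, fun k => ht0 _, htt, hlimx', hlimy',
      fun k => ⟨(hX _).1, (hX _).2.1⟩, fun k => ⟨(hY _).1, (hY _).2.1⟩, fun k => hXY _⟩
  · exact ⟨t ∘ ψ ∘ χ, Y ∘ ψ ∘ χ, X ∘ ψ ∘ χ, fun k => ht0 _, htt, hlimy', hlimx',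
      fun k => ⟨(hY _).1, (hY _).2.1⟩, fun k => ⟨(hX _).1, (hX _).2.1⟩,
      fun k => (hXY _).trans_eq (dist_comm _ _)⟩

theorem inner_grad_left_le (h : OptimalSetting f G H N m c C δ R r l S x y)
    (hu : inner ℝ (x - y) u = 0) : inner ℝ (G x) u ≤ 0 := by
  by_contra! hγ
  set D := ‖x - y‖ ^ 2 with hD
  have hD0 : 0 < D := by
    have := norm_pos_iff.2 (sub_ne_zero.2 h.ne)
    positivity
  obtain ⟨p, hp⟩ := h.exists_isPeak
  have hyS := h.symm.mem_left.1
  have hpy : p - y ∈ S.direction := AffineSubspace.vsub_mem_direction hp.1.1 hyS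
  have hxy : x - y ∈ S.direction := AffineSubspace.vsub_mem_direction h.mem_left.1 hyS
  have hgy : 0 < inner ℝ (G y) (p - y) := by
    have h1 := h.le_tangent h.symm.norm_left_lt.le hp.norm_lt.le hpy
    have h2 := h.peak_nonneg hp
    have h3 := h.symm.map_left
    have h4 := h.level_neg
    have h5 : 0 ≤ c / 64 * ‖p - y‖ ^ 2 := by
      have := h.form.c_pos
      positivity
    linarith
  set d := D⁻¹ • (x - y) with hd
  have hdu : inner ℝ d u = 0 := by rw [hd, inner_smul_left, hu, mul_zero]
  have hdx : inner ℝ d (x - y) = 1 := by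
    rw [hd, inner_smul_left, real_inner_self_eq_norm_sq, ← hD]
    simp [hD0.ne']
  obtain ⟨t, X, Y, ht0, ht, hX, hY, hXm, hYm, hXY⟩ := h.exists_seq hdu
  obtain ⟨ω, hω0, hω⟩ : ∃ ω : ℝ, 0 < ω ∧ 0 < inner ℝ (G x) (u + ω • (x - y)) := by
    have hc : ContinuousAt (fun ω : ℝ => inner ℝ (G x) (u + ω • (x - y))) 0 := by fun_prop
    obtain ⟨ω, h1, h2⟩ := (((hc.eventually_const_lt (u := 0) (by simpa using hγ)).filter_mono
      nhdsWithin_le_nhds).and (self_mem_nhdsWithin (s := Set.Ioi (0 : ℝ)))).exists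
    exact ⟨ω, h2, h1⟩
  obtain ⟨ω', hω'0, hω'⟩ : ∃ ω' : ℝ, 0 < ω' ∧ 0 < ω * D - ω' * inner ℝ (x - y) (p - y) := by
    have hc : ContinuousAt (fun ω' : ℝ => ω * D - ω' * inner ℝ (x - y) (p - y)) 0 := by fun_prop
    obtain ⟨ω', h1, h2⟩ := (((hc.eventually_const_lt (u := 0)
      (by simpa using mul_pos hω0 hD0)).filter_mono
      nhdsWithin_le_nhds).and (self_mem_nhdsWithin (s := Set.Ioi (0 : ℝ)))).exists
    exact ⟨ω', h2, h1⟩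
  set wX : ℕ → RSpace n := fun k => inner ℝ d (X k - y) • u + ω • (x - y) with hwX
  set wY : ℕ → RSpace n := fun k => inner ℝ d (Y k - y) • u + ω' • (p - y) with hwY
  have hwXlim : Tendsto wX atTop (𝓝 (u + ω • (x - y))) := by
    have := (((tendsto_const_nhds (x := d)).inner (hX.sub_const y) (𝕜 := ℝ)).smul_const
      u).add_const (ω • (x - y))
    rwa [hdx, one_smul] at this
  have hwYlim : Tendsto wY atTop (𝓝 (ω' • (p - y))) := by
    have := (((tendsto_const_nhds (x := d)).inner (hY.sub_const y) (𝕜 := ℝ)).smul_const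
      u).add_const (ω' • (p - y))
    simpa using this
  have hevX := eventually_le_of_tendsto h.model h.r_lt.le h.δ_nonneg hX h.norm_left_lt hwXlim ht
    ht0 (fun k => (hXm k).2) hω
  have hevY := eventually_le_of_tendsto h.model h.r_lt.le h.δ_nonneg hY h.symm.norm_left_lt hwYlim
    ht ht0 (fun k => (hYm k).2) (by rw [inner_smul_right]; positivity)
  have hlim : Tendsto (fun k => inner ℝ (X k - Y k) (wX k - wY k)) atTop
      (𝓝 (ω * D - ω' * inner ℝ (x - y) (p - y))) := by
    have := (hX.sub hY).inner (hwXlim.sub hwYlim) (𝕜 := ℝ)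
    convert this using 2
    rw [inner_sub_right _ (u + _), inner_add_right, inner_smul_right, inner_smul_right, hu,
      real_inner_self_eq_norm_sq, hD, zero_add]
  obtain ⟨k, ⟨kX1, kX2⟩, ⟨kY1, kY2⟩, kpos⟩ :=
    (hevX.and (hevY.and (hlim.eventually_const_lt hω'))).exists
  have hXS : X k + t k • wX k ∈ S := by
    have h1 := add_smul_mem hyS (S.direction.add_mem
      (mem_direction_of_mem_shearPlane hdu (hXm k).1) (S.direction.smul_mem (t k * ω) hxy)) 1
    convert h1 using 1
    simp only [hwX]
    module
  have hYS : Y k + t k • wY k ∈ S := by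
    have h1 := add_smul_mem hyS (S.direction.add_mem
      (mem_direction_of_mem_shearPlane hdu (hYm k).1) (S.direction.smul_mem (t k * ω') hpy)) 1
    convert h1 using 1
    simp only [hwY]
    module
  have hle := dist_le_diam_slice ⟨hXS, kX1, kX2⟩ ⟨hYS, kY1, kY2⟩
  rw [← h.triple.1.2.2.2.1] at hle
  have hlt : dist (X k) (Y k) ^ 2 < dist (X k + t k • wX k) (Y k + t k • wY k) ^ 2 := by
    rw [dist_eq_norm, dist_eq_norm]
    have : X k + t k • wX k - (Y k + t k • wY k) = (X k - Y k) + t k • (wX k - wY k) := by module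
    rw [this, norm_add_sq_real, inner_smul_right]
    have h1 := mul_pos (ht0 k) kpos
    have h2 : 0 ≤ ‖t k • (wX k - wY k)‖ ^ 2 := by positivity
    linarith
  have h3 := lt_of_pow_lt_pow_left₀ 2 dist_nonneg hlt
  have h4 := hXY k
  linarith

/-- The gradient at an endpoint of the unique diameter-attaining pair is parallel to `x - y`. -/
theorem inner_grad_left_eq_zero (h : OptimalSetting f G H N m c C δ R r l S x y)
    (hu : inner ℝ (x - y) u = 0) : inner ℝ (G x) u = 0 := by
  refine le_antisymm (h.inner_grad_left_le hu) ?_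
  have := h.inner_grad_left_le (u := -u) (by rw [inner_neg_right, hu, neg_zero])
  rw [inner_neg_right] at this
  linarith

end OptimalSetting

theorem norm_mul_norm_le_of_inner_eq_zero {g d : RSpace n}
    (h : ∀ u, inner ℝ d u = 0 → inner ℝ g u = 0) : ‖g‖ * ‖d‖ ≤ |inner ℝ g d| := by
  have h1 : inner ℝ d (‖d‖ ^ 2 • g - inner ℝ g d • d) = 0 := by
    rw [inner_sub_right, inner_smul_right, inner_smul_right, real_inner_self_eq_norm_sq,
      real_inner_comm g d]
    ring
  have h2 := h _ h1
  rw [inner_sub_right, inner_smul_right, inner_smul_right, real_inner_self_eq_norm_sq] at h2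
  refine abs_le_of_sq_le_sq' ?_ (abs_nonneg _) |>.2
  rw [sq_abs]
  nlinarith

section

variable {f : RSpace n → ℝ} {G : RSpace n → RSpace n} {H : RSpace n →L[ℝ] RSpace n}
  {N : Submodule ℝ (RSpace n)} {m : ℕ} {c C δ R r l : ℝ} {S : AffineSubspace ℝ (RSpace n)}
  {x y p u z : RSpace n}

namespace OptimalSetting

theorem norm_add_mul_norm_sub_le (h : OptimalSetting f G H N m c C δ R r l S x y) {δ' R' : ℝ}
    (h' : QuadModel f G H δ' R') (hδ' : 0 ≤ δ') (hx : ‖x‖ < R') (hy : ‖y‖ < R') :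
    c * ‖x + y‖ * ‖x - y‖ ≤ 4 * δ' * (‖x‖ + ‖y‖) ^ 2 := by
  set s := ‖x‖ + ‖y‖ with hs
  have hx0 := norm_nonneg x
  have hy0 := norm_nonneg y
  have hd : ‖x - y‖ ≤ s := norm_sub_le x y
  have e1 := h'.norm_grad_sub_le hx
  have e2 := h'.norm_grad_sub_le hy
  have e3 : ‖G x + G y - H (x + y)‖ ≤ δ' * s := by
    have : G x + G y - H (x + y) = (G x - H x) + (G y - H y) := by rw [map_add]; abel
    rw [this, hs, mul_add]
    exact (norm_add_le _ _).trans (add_le_add e1 e2)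
  have e4 : ‖G x + G y‖ * ‖x - y‖ ≤ |inner ℝ (G x + G y) (x - y)| := by
    refine norm_mul_norm_le_of_inner_eq_zero fun u hu => ?_
    have h1 := h.symm.inner_grad_left_eq_zero (u := u) (by rw [← neg_sub, inner_neg_left, hu, neg_zero])
    rw [inner_add_left, h.inner_grad_left_eq_zero hu, h1, zero_add]
  have e5 : |inner ℝ (H (x + y)) (x - y)| ≤ 2 * δ' * s ^ 2 := by
    have h1 : inner ℝ (H (x + y)) (x - y) = inner ℝ (H x) x - inner ℝ (H y) y := by
      have := h.form.symm x y
      rw [map_add, inner_add_left, inner_sub_right, inner_sub_right, this, real_inner_comm (H y) x]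
      ring
    have h2 := abs_le.1 (h'.abs_sub_le hx hδ')
    have h3 := abs_le.1 (h'.abs_sub_le hy hδ')
    rw [h.map_left] at h2
    rw [h.symm.map_left] at h3
    have h4 : δ' * (‖x‖ ^ 2 + ‖y‖ ^ 2) ≤ δ' * s ^ 2 := by
      gcongr
      nlinarith
    rw [h1, abs_le]
    constructor <;> linarith [h2.1, h2.2, h3.1, h3.2]
  have e6 : |inner ℝ (G x + G y) (x - y)| ≤ 3 * δ' * s ^ 2 := by
    have h1 := abs_real_inner_le_norm (G x + G y - H (x + y)) (x - y)
    rw [inner_sub_left] at h1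
    have h2 : ‖G x + G y - H (x + y)‖ * ‖x - y‖ ≤ δ' * s * s := by gcongr
    have h3 := abs_add_le (inner ℝ (G x + G y) (x - y) - inner ℝ (H (x + y)) (x - y))
      (inner ℝ (H (x + y)) (x - y))
    rw [sub_add_cancel] at h3
    nlinarith
  have e7 : ‖H (x + y)‖ ≤ ‖G x + G y‖ + δ' * s := by
    have h1 := norm_sub_le (G x + G y) (G x + G y - H (x + y))
    rw [sub_sub_cancel] at h1
    linarith
  have e8 := h.form.le_norm_apply (x + y)
  have e9 : δ' * s * ‖x - y‖ ≤ δ' * s * s := by gcongr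
  have e10 : c * ‖x + y‖ * ‖x - y‖ ≤ (‖G x + G y‖ + δ' * s) * ‖x - y‖ := by
    gcongr
    exact e8.trans e7
  nlinarith

/-- The midpoint of the optimal pair is much closer to the critical point than the two points. -/
theorem norm_midpoint_sq_le (h : OptimalSetting f G H N m c C δ R r l S x y) {δ' R' : ℝ}
    (h' : QuadModel f G H δ' R') (hδ' : 0 ≤ δ') (hx : ‖x‖ < R') (hy : ‖y‖ < R') :
    ‖midpoint ℝ x y‖ ^ 2 ≤ 4 * 24576 ^ 2 * C ^ 3 / c ^ 6 * δ' ^ 2 * |l| := by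
  have hc := h.form.c_pos
  have hC : 0 < C := hc.trans_le h.form.c_le
  have hl : 0 < |l| := abs_pos.2 h.level_neg.ne
  have h1 := h.norm_add_mul_norm_sub_le h' hδ' hx hy
  have h2 := h.norm_left_sq_le
  have h3 := h.symm.norm_left_sq_le
  have h4 := h.level_le
  rw [dist_eq_norm] at h4
  have h5 : c ^ 2 * (‖x‖ + ‖y‖) ^ 2 ≤ 24576 * C * |l| := by
    have : (‖x‖ + ‖y‖) ^ 2 ≤ 2 * ‖x‖ ^ 2 + 2 * ‖y‖ ^ 2 := by
      nlinarith [sq_nonneg (‖x‖ - ‖y‖)]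
    calc c ^ 2 * (‖x‖ + ‖y‖) ^ 2 ≤ c ^ 2 * (2 * ‖x‖ ^ 2 + 2 * ‖y‖ ^ 2) := by gcongr
      _ ≤ _ := by linarith
  have h6 : c ^ 2 * (c * ‖x + y‖ * ‖x - y‖) ≤ 4 * δ' * (24576 * C * |l|) := by
    calc _ ≤ c ^ 2 * (4 * δ' * (‖x‖ + ‖y‖) ^ 2) := by gcongr
      _ = 4 * δ' * (c ^ 2 * (‖x‖ + ‖y‖) ^ 2) := by ring
      _ ≤ _ := by gcongr
  have h7 : (c ^ 2 * (c * ‖x + y‖ * ‖x - y‖)) ^ 2 ≤ (4 * δ' * (24576 * C * |l|)) ^ 2 := by gcongr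
  have h8 : c ^ 6 * ‖x + y‖ ^ 2 * |l| ≤ (4 * δ' * (24576 * C * |l|)) ^ 2 * C := by
    calc c ^ 6 * ‖x + y‖ ^ 2 * |l| ≤ c ^ 6 * ‖x + y‖ ^ 2 * (C * ‖x - y‖ ^ 2) := by gcongr
      _ = (c ^ 2 * (c * ‖x + y‖ * ‖x - y‖)) ^ 2 * C := by ring
      _ ≤ _ := by gcongr
  have h9 : c ^ 6 * ‖x + y‖ ^ 2 ≤ 16 * 24576 ^ 2 * C ^ 3 * δ' ^ 2 * |l| := by
    refine le_of_mul_le_mul_right ?_ hl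
    calc _ ≤ _ := h8
      _ = _ := by ring
  have h10 : ‖midpoint ℝ x y‖ = ‖x + y‖ / 2 := by
    rw [midpoint_eq_smul_add, norm_smul]
    simp
    ring
  rw [h10, div_mul_eq_mul_div, div_mul_eq_mul_div, le_div_iff₀ (by positivity)]
  linarith

end OptimalSetting

/-! ### The next level -/

theorem SaddleForm.exists_mem_sub_mem_orthogonal (hH : SaddleForm H N m c C)
    {L : Submodule ℝ (RSpace n)} {a : ℝ} (hL : Module.finrank ℝ L = m) (ha : 0 < a)
    (hpos : ∀ u ∈ Lᗮ, a * ‖u‖ ^ 2 ≤ inner ℝ (H u) u) (z : RSpace n) :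
    ∃ w ∈ N, w - z ∈ Lᗮ ∧ c * ‖w‖ ≤ 3 * C * ‖z‖ := by
  have hc := hH.c_pos
  have hC := hH.c_le
  have hC0 : 0 < C := hc.trans_le hC
  obtain ⟨w, hw, u, hu, hwu⟩ := exists_add_eq_of_disjoint (V := N) (W := Lᗮ) (by
    rw [Submodule.disjoint_def]
    intro v hv hv'
    have h1 := hH.neg v hv
    have h2 := hpos v hv'
    by_contra h0
    have h3 : 0 < ‖v‖ ^ 2 := by positivity
    nlinarith) (by
    have h2 := L.finrank_add_finrank_orthogonal
    rw [hL] at h2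
    simp at h2
    rw [hH.finrank_eq]
    omega) z
  have huz : u = z - w := by simp [← hwu]
  refine ⟨w, hw, ?_, ?_⟩
  · rw [← neg_sub, ← huz]
    exact Submodule.neg_mem _ hu
  · have h1 := hpos u hu
    have h2 := hH.inner_sub_self z w
    rw [← huz] at h2
    have h3 := hH.neg w hw
    have h4 := (abs_le.1 (hH.abs_inner_le z z)).2
    have h5 := (abs_le.1 (hH.abs_inner_le z w)).1
    have h6 : c * ‖w‖ ^ 2 ≤ C * ‖z‖ ^ 2 + 2 * C * ‖z‖ * ‖w‖ := by
      have : 0 ≤ a * ‖u‖ ^ 2 := by positivity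
      nlinarith
    by_contra! hlt
    have h7 : C * ‖z‖ ≤ c * ‖w‖ := by
      have : 0 ≤ C * ‖z‖ := by positivity
      linarith
    have hw0 : 0 < ‖w‖ := by
      by_contra h0
      have : ‖w‖ = 0 := le_antisymm (not_lt.1 h0) (norm_nonneg _)
      rw [this] at hlt
      have : 0 ≤ C * ‖z‖ := by positivity
      linarith
    have h8 : ‖z‖ ≤ ‖w‖ := by
      by_contra! h9
      have : c * ‖w‖ < C * ‖z‖ := by
        calc c * ‖w‖ ≤ C * ‖w‖ := by gcongr
          _ < C * ‖z‖ := by gcongr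
      linarith
    have h9 : C * ‖z‖ * ‖z‖ ≤ C * ‖z‖ * ‖w‖ := by gcongr
    nlinarith

theorem QuadModel.le_map_add (h : QuadModel f G H δ R) (hH : SaddleForm H N m c C)
    (hδ : 0 ≤ δ) (hδc : 32 * δ ≤ c) (hpos : c / 4 * ‖u‖ ^ 2 ≤ inner ℝ (H u) u)
    (hR : ‖z + u‖ < R) : -(8 * C ^ 2 / c * ‖z‖ ^ 2) ≤ f (z + u) := by
  have hc := hH.c_pos
  have hC := hH.c_le
  have h1 := (abs_le.1 (h.abs_sub_le hR hδ)).1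
  rw [hH.inner_add_self] at h1
  have h2 := (abs_le.1 (hH.abs_inner_le z z)).1
  have h3 := (abs_le.1 (hH.abs_inner_le z u)).1
  have h4 : ‖z + u‖ ^ 2 ≤ 2 * ‖z‖ ^ 2 + 2 * ‖u‖ ^ 2 := by
    have := norm_add_le z u
    nlinarith [sq_nonneg (‖z‖ - ‖u‖), norm_nonneg (z + u)]
  have h5 : δ * ‖z + u‖ ^ 2 ≤ c / 32 * (2 * ‖z‖ ^ 2 + 2 * ‖u‖ ^ 2) := by
    gcongr
    linarith
  have h6 : C * ‖z‖ * ‖u‖ ≤ c / 16 * ‖u‖ ^ 2 + 4 * C ^ 2 / c * ‖z‖ ^ 2 := by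
    have : c / 16 * ‖u‖ ^ 2 + 4 * C ^ 2 / c * ‖z‖ ^ 2 - C * ‖z‖ * ‖u‖
        = (c * ‖u‖ - 8 * C * ‖z‖) ^ 2 / (16 * c) := by
      field_simp
      ring
    have h7 : 0 ≤ (c * ‖u‖ - 8 * C * ‖z‖) ^ 2 / (16 * c) := by positivity
    linarith
  have h7 : C ≤ C ^ 2 / c := by rw [le_div_iff₀ hc]; nlinarith
  have h8 : C * ‖z‖ ^ 2 ≤ C ^ 2 / c * ‖z‖ ^ 2 := by gcongr
  have h9 : c * ‖z‖ ^ 2 ≤ C * ‖z‖ ^ 2 := by gcongr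
  have e1 : 8 * C ^ 2 / c * ‖z‖ ^ 2 = 8 * (C ^ 2 / c * ‖z‖ ^ 2) := by ring
  have e2 : 4 * C ^ 2 / c * ‖z‖ ^ 2 = 4 * (C ^ 2 / c * ‖z‖ ^ 2) := by ring
  rw [e2] at h6
  rw [e1]
  nlinarith

theorem exists_isNextLevel (h : QuadModel f G H δ R) (hH : SaddleForm H N m c C)
    (hδ : 0 ≤ δ) (hδc : 32 * δ ≤ c) (hr : r ≤ R) {L : Submodule ℝ (RSpace n)}
    (hL : Module.finrank ℝ L = m) (hpos : ∀ u ∈ Lᗮ, c / 4 * ‖u‖ ^ 2 ≤ inner ℝ (H u) u)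
    (hz : 3 * C * ‖midpoint ℝ x y‖ < c * r) :
    ∃ l', IsNextLevel f (Metric.ball 0 r) x y L l' ∧
      -(8 * C ^ 2 / c * ‖midpoint ℝ x y‖ ^ 2) ≤ l' ∧ l' ≤ 0 := by
  have hc := hH.c_pos
  set z := midpoint ℝ x y
  obtain ⟨w, hw, hwz, hwn⟩ := hH.exists_mem_sub_mem_orthogonal hL (by positivity) hpos z
  have hwr : ‖w‖ < r := lt_of_mul_lt_mul_left (hwn.trans_lt hz) hc.le
  have hfw : f w ≤ 0 := by
    have := h.le_neg_of_mem hδ hH (by linarith) hw (hwr.trans_le hr)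
    have h2 : 0 ≤ c / 4 * ‖w‖ ^ 2 := by positivity
    linarith
  set A := f '' {w | w ∈ Metric.ball 0 r ∧ w - z ∈ Lᗮ}
  have hwA : f w ∈ A := ⟨w, ⟨by simpa using hwr, hwz⟩, rfl⟩
  have hlb : -(8 * C ^ 2 / c * ‖z‖ ^ 2) ∈ lowerBounds A := by
    rintro _ ⟨q, ⟨hq, hqz⟩, rfl⟩
    have := h.le_map_add hH hδ hδc (hpos _ hqz) (z := z)
      (by rw [add_sub_cancel]; exact (mem_ball_zero_iff.1 hq).trans_le hr)
    rwa [add_sub_cancel] at this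
  have hglb : IsGLB A (sInf A) := isGLB_csInf ⟨_, hwA⟩ ⟨_, hlb⟩
  exact ⟨sInf A, hglb, hglb.2 hlb, (hglb.1 hwA).trans hfw⟩

/-! ### Subspaces that are nearly invariant and negative definite -/

/-- `X` is a `j`-dimensional subspace that is almost invariant under `H`, and on which `H` is
negative definite. -/
structure NearlyInvariant (H : RSpace n →L[ℝ] RSpace n) (X : Submodule ℝ (RSpace n)) (j : ℕ)
    (κ a : ℝ) : Prop where
  finrank_eq : Module.finrank ℝ X = j
  cross : ∀ v ∈ X, ∀ w ∈ Xᗮ, |inner ℝ (H v) w| ≤ κ * ‖v‖ * ‖w‖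
  neg : ∀ v ∈ X, inner ℝ (H v) v ≤ -a * ‖v‖ ^ 2

theorem nearlyInvariant_bot (a : ℝ) : NearlyInvariant H ⊥ 0 0 a where
  finrank_eq := finrank_bot _ _
  cross v hv w _ := by
    rw [Submodule.mem_bot] at hv
    simp [hv]
  neg v hv := by
    rw [Submodule.mem_bot] at hv
    simp [hv]

theorem finrank_sup_span_singleton {X : Submodule ℝ (RSpace n)} (hu : u ∈ Xᗮ) (hu0 : u ≠ 0) :
    Module.finrank ℝ (X ⊔ Submodule.span ℝ {u} : Submodule ℝ (RSpace n))
      = Module.finrank ℝ X + 1 := by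
  have h1 := Submodule.finrank_sup_add_finrank_inf_eq X (Submodule.span ℝ {u})
  have h2 : X ⊓ Submodule.span ℝ {u} = ⊥ := by
    have : Submodule.span ℝ {u} ≤ Xᗮ := (Submodule.span_singleton_le_iff_mem _ _).2 hu
    exact ((Submodule.orthogonal_disjoint X).mono_right this).eq_bot
  rw [h2, finrank_bot, finrank_span_singleton hu0] at h1
  omega

theorem NearlyInvariant.sup_span {X : Submodule ℝ (RSpace n)} {j : ℕ} {κ κ' a : ℝ}
    (h : NearlyInvariant H X j κ a) (hH : SaddleForm H N m c C) (hκ : 0 ≤ κ) (hκ' : 0 ≤ κ')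
    (hu : u ∈ Xᗮ) (hu0 : u ≠ 0) (hneg : inner ℝ (H u) u ≤ -a * ‖u‖ ^ 2)
    (hcross : ∀ w ∈ Xᗮ, inner ℝ u w = 0 → |inner ℝ (H u) w| ≤ κ' * ‖u‖ * ‖w‖) :
    NearlyInvariant H (X ⊔ Submodule.span ℝ {u}) (j + 1) (κ + κ') (a - κ) := by
  have hdec : ∀ q ∈ X ⊔ Submodule.span ℝ {u}, ∃ v ∈ X, ∃ t : ℝ, q = v + t • u ∧
      ‖v‖ ≤ ‖q‖ ∧ ‖t • u‖ ≤ ‖q‖ ∧ ‖q‖ ^ 2 = ‖v‖ ^ 2 + ‖t • u‖ ^ 2 := by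
    intro q hq
    obtain ⟨v, hv, s, hs, rfl⟩ := Submodule.mem_sup.1 hq
    obtain ⟨t, rfl⟩ := Submodule.mem_span_singleton.1 hs
    have h1 : inner ℝ v (t • u) = 0 :=
      (Submodule.mem_orthogonal _ _).1 (Submodule.smul_mem _ t hu) v hv
    have h2 : ‖v + t • u‖ ^ 2 = ‖v‖ ^ 2 + ‖t • u‖ ^ 2 := by rw [norm_add_sq_real, h1]; ring
    refine ⟨v, hv, t, rfl, ?_, ?_, h2⟩
    · refine (sq_le_sq₀ (norm_nonneg _) (norm_nonneg _)).1 ?_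
      nlinarith [sq_nonneg ‖t • u‖]
    · refine (sq_le_sq₀ (norm_nonneg _) (norm_nonneg _)).1 ?_
      nlinarith [sq_nonneg ‖v‖]
  refine ⟨by rw [finrank_sup_span_singleton hu hu0, h.finrank_eq], fun q hq w hw => ?_,
    fun q hq => ?_⟩
  · obtain ⟨v, hv, t, rfl, h1, h2, -⟩ := hdec q hq
    have hwX : w ∈ Xᗮ := Submodule.orthogonal_le le_sup_left hw
    have hwu : inner ℝ u w = 0 := (Submodule.mem_orthogonal _ _).1 hw u
      (le_sup_right (a := X) (Submodule.mem_span_singleton_self u))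
    have h3 := h.cross v hv w hwX
    have h4 : |inner ℝ (H (t • u)) w| ≤ κ' * ‖t • u‖ * ‖w‖ := by
      rw [map_smul, inner_smul_left, norm_smul, abs_mul, RCLike.conj_to_real, Real.norm_eq_abs]
      calc |t| * |inner ℝ (H u) w| ≤ |t| * (κ' * ‖u‖ * ‖w‖) := by gcongr; exact hcross w hwX hwu
        _ = _ := by ring
    rw [map_add, inner_add_left]
    calc _ ≤ κ * ‖v‖ * ‖w‖ + κ' * ‖t • u‖ * ‖w‖ := (abs_add_le _ _).trans (add_le_add h3 h4)
      _ ≤ κ * ‖v + t • u‖ * ‖w‖ + κ' * ‖v + t • u‖ * ‖w‖ := by gcongr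
      _ = _ := by ring
  · obtain ⟨v, hv, t, rfl, -, -, h2⟩ := hdec q hq
    rw [hH.inner_add_self, h2]
    have h3 := h.neg v hv
    have h4 := (abs_le.1 (h.cross v hv (t • u) (Submodule.smul_mem _ t hu))).2
    have h5 : inner ℝ (H (t • u)) (t • u) ≤ -a * ‖t • u‖ ^ 2 := by
      rw [map_smul, inner_smul_left, inner_smul_right, norm_smul, mul_pow, Real.norm_eq_abs,
        sq_abs, RCLike.conj_to_real]
      nlinarith [sq_nonneg t]
    have h6 : κ * (2 * (‖v‖ * ‖t • u‖)) ≤ κ * (‖v‖ ^ 2 + ‖t • u‖ ^ 2) := by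
      gcongr
      nlinarith [sq_nonneg (‖v‖ - ‖t • u‖)]
    nlinarith

theorem NearlyInvariant.le_inner_of_mem_orthogonal {X : Submodule ℝ (RSpace n)} {κ a : ℝ}
    (h : NearlyInvariant H X m κ a) (hH : SaddleForm H N m c C) (ha : 0 ≤ a) (hκ : 0 ≤ κ)
    (hκc : 2 * κ ≤ c) {w : RSpace n} (hw : w ∈ Xᗮ) : c / 2 * ‖w‖ ^ 2 ≤ inner ℝ (H w) w := by
  have hc := hH.c_pos
  obtain ⟨v, hv, w', hw', hvw⟩ := exists_add_eq_of_disjoint (V := X) (W := Nᗮ) (by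
    rw [Submodule.disjoint_def]
    intro v hv hv'
    have h1 := h.neg v hv
    have h2 := hH.pos v hv'
    by_contra h0
    have h3 : 0 < ‖v‖ ^ 2 := by positivity
    nlinarith) (by
    have h2 := N.finrank_add_finrank_orthogonal
    rw [hH.finrank_eq] at h2
    simp at h2
    rw [h.finrank_eq]
    omega) w
  have h1 : w' = w - v := by simp [← hvw]
  have h2 := hH.pos w' hw'
  have h3 := hH.inner_sub_self w v
  have h4 : inner ℝ (H w) v = inner ℝ (H v) w := by rw [hH.symm, real_inner_comm]
  have h5 := (abs_le.1 (h.cross v hv w hw)).1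
  have h6 := h.neg v hv
  have h7 : inner ℝ w v = 0 := by
    rw [real_inner_comm]; exact (Submodule.mem_orthogonal _ _).1 hw v hv
  rw [h1, h3, h4, norm_sub_sq_real, h7] at h2
  have h8 : 0 ≤ a * ‖v‖ ^ 2 := by positivity
  have h9 : κ * (2 * (‖v‖ * ‖w‖)) ≤ κ * (‖v‖ ^ 2 + ‖w‖ ^ 2) := by
    gcongr
    nlinarith [sq_nonneg (‖v‖ - ‖w‖)]
  have h10 : κ * (‖v‖ ^ 2 + ‖w‖ ^ 2) ≤ c / 2 * (‖v‖ ^ 2 + ‖w‖ ^ 2) := by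
    gcongr
    linarith
  have h11 : 0 ≤ c / 2 * ‖v‖ ^ 2 := by positivity
  nlinarith

theorem SaddleForm.le_inner_of_starProjection (hH : SaddleForm H N m c C)
    {L X : Submodule ℝ (RSpace n)} (hX : ∀ w ∈ Xᗮ, c / 2 * ‖w‖ ^ 2 ≤ inner ℝ (H w) w)
    (hLX : ‖L.starProjection - X.starProjection‖ ≤ c / (16 * C)) (hu : u ∈ Lᗮ) :
    c / 4 * ‖u‖ ^ 2 ≤ inner ℝ (H u) u := by
  have hc := hH.c_pos
  have hcC := hH.c_le
  have hC : 0 < C := hc.trans_le hcC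
  set b := X.starProjection u with hb
  have h0 : L.starProjection u = 0 := by
    rwa [Submodule.starProjection_apply_eq_zero_iff]
  set ε := c / (16 * C) with hε
  have hε0 : 0 ≤ ε := by positivity
  have hεC : C * ε = c / 16 := by rw [hε]; field_simp
  have hε1 : ε ≤ 1 / 16 := by rw [hε, div_le_div_iff₀ (by positivity) (by norm_num)]; linarith
  have h1 : ‖b‖ ≤ ε * ‖u‖ := by
    have := (L.starProjection - X.starProjection).le_opNorm u
    rw [sub_apply, h0, zero_sub, norm_neg] at this
    exact this.trans (by gcongr)
  have hbX : b ∈ X := Submodule.starProjection_apply_mem _ _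
  have hu' : u - b ∈ Xᗮ := Submodule.sub_starProjection_mem_orthogonal u
  have h2 := hX _ hu'
  have h3 := hH.inner_add_self (u - b) b
  rw [sub_add_cancel] at h3
  have h4 : ‖u‖ ^ 2 = ‖u - b‖ ^ 2 + ‖b‖ ^ 2 := by
    have h5 : inner ℝ (u - b) b = 0 := by
      rw [real_inner_comm]; exact (Submodule.mem_orthogonal _ _).1 hu' b hbX
    have := norm_add_sq_real (u - b) b
    rw [sub_add_cancel, h5] at this
    linarith
  have h5 : ‖u - b‖ ≤ ‖u‖ := by
    refine (sq_le_sq₀ (norm_nonneg _) (norm_nonneg _)).1 ?_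
    nlinarith [sq_nonneg ‖b‖]
  have h6 := (abs_le.1 (hH.abs_inner_le (u - b) b)).1
  have h7 := (abs_le.1 (hH.abs_inner_le b b)).1
  have h8 : C * ‖u - b‖ * ‖b‖ ≤ c / 16 * ‖u‖ ^ 2 := by
    calc C * ‖u - b‖ * ‖b‖ ≤ C * ‖u‖ * (ε * ‖u‖) := by gcongr
      _ = (C * ε) * ‖u‖ ^ 2 := by ring
      _ = _ := by rw [hεC]
  have h9 : C * ‖b‖ * ‖b‖ ≤ c / 256 * ‖u‖ ^ 2 := by
    calc C * ‖b‖ * ‖b‖ ≤ C * (1 / 16 * ‖u‖) * (ε * ‖u‖) := by gcongr; exact h1.trans (by gcongr)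
      _ = (C * ε) * ‖u‖ ^ 2 / 16 := by ring
      _ = _ := by rw [hεC]; ring
  have h10 : c * ‖b‖ ^ 2 ≤ C * ‖b‖ * ‖b‖ := by nlinarith [sq_nonneg ‖b‖]
  nlinarith [sq_nonneg ‖u‖]

end

section

variable {f : RSpace n → ℝ} {G : RSpace n → RSpace n} {H : RSpace n →L[ℝ] RSpace n}
  {N : Submodule ℝ (RSpace n)} {m : ℕ} {c C δ R r l κ : ℝ} {S : AffineSubspace ℝ (RSpace n)}
  {x y p u z w : RSpace n} {X : Submodule ℝ (RSpace n)}

/-! ### Closest points of sublevel sets -/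

theorem IsClosestPoint.inner_grad_nonneg (hp : IsClosestPoint f l z X p)
    (h : QuadModel f G H δ R) (hpz : p ≠ z) (hw : w ∈ Xᗮ) (hwp : inner ℝ (p - z) w = 0) :
    0 ≤ inner ℝ (G p) w := by
  by_contra! hlt
  obtain ⟨τ, hτ0, hτ⟩ : ∃ τ : ℝ, 0 < τ ∧ inner ℝ (G p) (w - τ • (p - z)) < 0 := by
    have hc : ContinuousAt (fun τ : ℝ => inner ℝ (G p) (w - τ • (p - z))) 0 := by fun_prop
    obtain ⟨τ, h1, h2⟩ := (((hc.eventually_lt_const (u := 0) (by simpa using hlt)).filter_mono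
      nhdsWithin_le_nhds).and (self_mem_nhdsWithin (s := Set.Ioi (0 : ℝ)))).exists
    exact ⟨τ, h2, h1⟩
  set e := w - τ • (p - z) with he
  have heX : e ∈ Xᗮ := Submodule.sub_mem _ hw (Submodule.smul_mem _ _ hp.1.2)
  have h1 := (h.hasDerivAt_line p e 0).tendsto_slope_zero_right
  simp only [zero_smul, add_zero, zero_add] at h1
  have h2 := h1.eventually_lt_const hτ
  have hpe : inner ℝ (p - z) e < 0 := by
    rw [he, inner_sub_right, hwp, inner_smul_right, real_inner_self_eq_norm_sq]
    have := norm_pos_iff.2 (sub_ne_zero.2 hpz)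
    have : 0 < τ * ‖p - z‖ ^ 2 := by positivity
    linarith
  have h3 : ∀ᶠ t : ℝ in 𝓝[>] 0, 2 * inner ℝ (p - z) e + t * ‖e‖ ^ 2 < 0 := by
    have hc : ContinuousAt (fun t : ℝ => 2 * inner ℝ (p - z) e + t * ‖e‖ ^ 2) 0 := by fun_prop
    exact (hc.eventually_lt_const (u := 0) (by simp; linarith)).filter_mono nhdsWithin_le_nhds
  obtain ⟨t, ht1, ht2, ht⟩ := (h2.and (h3.and self_mem_nhdsWithin)).exists
  have ht0 : (0 : ℝ) < t := ht
  have h4 : f (p + t • e) ≤ l := by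
    rw [smul_eq_mul, inv_mul_lt_iff₀ ht0, mul_zero] at ht1
    linarith [hp.1.1]
  have h5 := hp.2 _ h4 (by
    rw [add_sub_right_comm]
    exact Submodule.add_mem _ hp.1.2 (Submodule.smul_mem _ _ heX))
  rw [dist_comm, dist_comm z, dist_eq_norm, dist_eq_norm, add_sub_right_comm] at h5
  have h6 : ‖p - z‖ ^ 2 ≤ ‖p - z + t • e‖ ^ 2 := by gcongr
  rw [norm_add_sq_real, inner_smul_right, norm_smul, mul_pow, Real.norm_eq_abs, sq_abs] at h6
  have h7 := mul_neg_of_pos_of_neg ht0 ht2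
  nlinarith

theorem IsClosestPoint.inner_grad_eq_zero (hp : IsClosestPoint f l z X p)
    (h : QuadModel f G H δ R) (hpz : p ≠ z) (hw : w ∈ Xᗮ) (hwp : inner ℝ (p - z) w = 0) :
    inner ℝ (G p) w = 0 := by
  refine le_antisymm ?_ (hp.inner_grad_nonneg h hpz hw hwp)
  have := hp.inner_grad_nonneg h hpz (Submodule.neg_mem _ hw)
    (by rw [inner_neg_right, hwp, neg_zero])
  rw [inner_neg_right] at this
  linarith

/-- Points of level `l` at distance of order `√|l|` from a point `z` that is close to the origin
lie in directions of negative curvature. -/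
theorem QuadModel.inner_hessian_le_neg_level (h : QuadModel f G H δ R) (hH : SaddleForm H N m c C)
    (hδ : 0 ≤ δ) (hδc : 256 * δ ≤ c) (hl : l < 0) (hz : 68 * C ^ 2 * ‖z‖ ^ 2 ≤ c * |l|)
    (hu : c * ‖u‖ ^ 2 ≤ 8 * |l|) (hR : ‖z + u‖ < R) (hf : f (z + u) ≤ l) :
    inner ℝ (H u) u ≤ -|l| := by
  have hc := hH.c_pos
  have hC := hH.c_le
  have hlabs : |l| = -l := abs_of_neg hl
  have h1 := (abs_le.1 (h.abs_sub_le hR hδ)).1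
  rw [hH.inner_add_self] at h1
  have h2 := (abs_le.1 (hH.abs_inner_le z z)).1
  have h3 := (abs_le.1 (hH.abs_inner_le z u)).1
  have h4 : ‖z + u‖ ^ 2 ≤ 2 * ‖z‖ ^ 2 + 2 * ‖u‖ ^ 2 := by
    have := norm_add_le z u
    nlinarith [sq_nonneg (‖z‖ - ‖u‖), norm_nonneg (z + u)]
  have h5 : δ * ‖z + u‖ ^ 2 ≤ c / 256 * (2 * ‖z‖ ^ 2 + 2 * ‖u‖ ^ 2) := by
    gcongr
    linarith
  have h6 : 2 * C * ‖z‖ * ‖u‖ ≤ c / 32 * ‖u‖ ^ 2 + 32 * (C ^ 2 / c * ‖z‖ ^ 2) := by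
    have : c / 32 * ‖u‖ ^ 2 + 32 * (C ^ 2 / c * ‖z‖ ^ 2) - 2 * C * ‖z‖ * ‖u‖
        = (c * ‖u‖ - 32 * C * ‖z‖) ^ 2 / (32 * c) := by
      field_simp
      ring
    have h7 : 0 ≤ (c * ‖u‖ - 32 * C * ‖z‖) ^ 2 / (32 * c) := by positivity
    linarith
  have h7 : C ≤ C ^ 2 / c := by rw [le_div_iff₀ hc]; nlinarith
  have h8 : C * ‖z‖ ^ 2 ≤ C ^ 2 / c * ‖z‖ ^ 2 := by gcongr
  have h9 : c * ‖z‖ ^ 2 ≤ C * ‖z‖ ^ 2 := by gcongr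
  have h10 : 68 * (C ^ 2 / c * ‖z‖ ^ 2) ≤ |l| := by
    have : 68 * (C ^ 2 / c * ‖z‖ ^ 2) = 68 * C ^ 2 * ‖z‖ ^ 2 / c := by ring
    rw [this, div_le_iff₀ hc]
    linarith
  nlinarith

theorem QuadModel.abs_inner_hessian_le (h : QuadModel f G H δ R) (hH : SaddleForm H N m c C)
    (hδc : 256 * δ ≤ c) (hκ : 0 ≤ κ) (hδκ : 2 * δ ≤ κ)
    (hz : 16 * C ^ 3 * ‖z‖ ^ 2 ≤ κ ^ 2 * |l|) (hR : ‖z + u‖ < R) (hδ : 0 ≤ δ)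
    (hneg : inner ℝ (H u) u ≤ -|l|) (hw : inner ℝ (G (z + u)) w = 0) :
    |inner ℝ (H u) w| ≤ κ * ‖u‖ * ‖w‖ := by
  have hc := hH.c_pos
  have hC : 0 < C := hc.trans_le hH.c_le
  have h1 := (abs_le.1 (hH.abs_inner_le u u)).1
  have h2 : |l| ≤ C * ‖u‖ ^ 2 := by nlinarith
  have h3 : 4 * C * ‖z‖ ≤ κ * ‖u‖ := by
    refine (sq_le_sq₀ (by positivity) (by positivity)).1 ?_
    refine le_of_mul_le_mul_right ?_ hC
    calc (4 * C * ‖z‖) ^ 2 * C = 16 * C ^ 3 * ‖z‖ ^ 2 := by ring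
      _ ≤ κ ^ 2 * |l| := hz
      _ ≤ κ ^ 2 * (C * ‖u‖ ^ 2) := by gcongr
      _ = _ := by ring
  have h4 := h.abs_inner_le_of_inner_grad_eq_zero hR hw
  have h5 := hH.abs_inner_le z w
  have h6 : inner ℝ (H u) w = inner ℝ (H (z + u)) w - inner ℝ (H z) w := by
    rw [map_add, inner_add_left]; ring
  rw [h6]
  calc _ ≤ |inner ℝ (H (z + u)) w| + |inner ℝ (H z) w| := abs_sub _ _
    _ ≤ δ * (‖z‖ + ‖u‖) * ‖w‖ + C * ‖z‖ * ‖w‖ := by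
        refine add_le_add (h4.trans ?_) h5
        gcongr
        exact norm_add_le _ _
    _ = (δ * ‖z‖ + δ * ‖u‖ + C * ‖z‖) * ‖w‖ := by ring
    _ ≤ (κ * ‖u‖) * ‖w‖ := by
        gcongr
        have e1 : δ * ‖z‖ ≤ C * ‖z‖ := by
          gcongr
          linarith [hH.c_le]
        have e2 : 2 * δ * ‖u‖ ≤ κ * ‖u‖ := by gcongr
        linarith

/-- There is a point of the sublevel set at distance of order `√|l|` in every subspace of small
codimension. -/
theorem QuadModel.exists_le_level (h : QuadModel f G H δ R) (hH : SaddleForm H N m c C)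
    (hδ : 0 ≤ δ) (hδc : 256 * δ ≤ c) (hr : r ≤ R) (hr0 : 0 < r) (hl : l < 0)
    (hlr : 6144 * C * |l| < c ^ 2 * r ^ 2)
    (hz : 68 * C ^ 2 * ‖z‖ ^ 2 ≤ c * |l|) (hX : Module.finrank ℝ X < m) :
    ∃ v ∈ Xᗮ, f (z + v) ≤ l ∧ c * ‖v‖ ^ 2 = 8 * |l| := by
  have hc := hH.c_pos
  have hC := hH.c_le
  have hC0 : 0 < C := hc.trans_le hC
  have hlabs : |l| = -l := abs_of_neg hl
  have hl0 : 0 < |l| := abs_pos.2 hl.ne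
  obtain ⟨v₀, hv₀N, hv₀X, hv₀⟩ : ∃ v ∈ N, v ∈ Xᗮ ∧ v ≠ 0 := by
    by_contra! hcon
    have h1 := Submodule.finrank_add_finrank_le_of_disjoint (Submodule.disjoint_def.2 hcon)
    have h2 := X.finrank_add_finrank_orthogonal
    rw [hH.finrank_eq] at h1
    simp at h1 h2
    omega
  have hv₀n := norm_pos_iff.2 hv₀
  set v := (√(8 * |l| / c) / ‖v₀‖) • v₀ with hv
  have hvn : ‖v‖ ^ 2 = 8 * |l| / c := by
    rw [hv, norm_smul, Real.norm_of_nonneg (by positivity), div_mul_cancel₀ _ hv₀n.ne',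
      Real.sq_sqrt (by positivity)]
  have hvc : c * ‖v‖ ^ 2 = 8 * |l| := by rw [hvn]; field_simp
  refine ⟨v, Submodule.smul_mem _ _ hv₀X, ?_, hvc⟩
  have hlr' : 6144 * |l| < c * r ^ 2 := by
    have h1 : c * (6144 * |l|) < c * (c * r ^ 2) := by
      calc c * (6144 * |l|) ≤ C * (6144 * |l|) := by gcongr
        _ = 6144 * C * |l| := by ring
        _ < _ := hlr
        _ = _ := by ring
    exact lt_of_mul_lt_mul_left h1 hc.le
  have hvr : ‖v‖ < r / 2 := by
    refine lt_of_pow_lt_pow_left₀ 2 (by positivity) (lt_of_mul_lt_mul_left ?_ hc.le)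
    rw [hvc]
    have : c * (r / 2) ^ 2 = c * r ^ 2 / 4 := by ring
    linarith
  have hzr : ‖z‖ < r / 2 := by
    refine lt_of_pow_lt_pow_left₀ 2 (by positivity) (lt_of_mul_lt_mul_left ?_ hc.le)
    have h1 : c * (c * ‖z‖ ^ 2) ≤ c * |l| := by
      calc c * (c * ‖z‖ ^ 2) = c ^ 2 * ‖z‖ ^ 2 := by ring
        _ ≤ 68 * C ^ 2 * ‖z‖ ^ 2 := by
            gcongr
            have : c ^ 2 ≤ C ^ 2 := by gcongr
            linarith [sq_nonneg C]
        _ ≤ _ := hz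
    have h2 := le_of_mul_le_mul_left h1 hc
    have : c * (r / 2) ^ 2 = c * r ^ 2 / 4 := by ring
    linarith
  have hR : ‖z + v‖ < R := by linarith [norm_add_le z v]
  have h1 := (abs_le.1 (h.abs_sub_le hR hδ)).2
  rw [hH.inner_add_self] at h1
  have h2 := (abs_le.1 (hH.abs_inner_le z z)).2
  have h3 := (abs_le.1 (hH.abs_inner_le z v)).2
  have h3' := hH.neg v (Submodule.smul_mem _ _ hv₀N)
  have h4 : ‖z + v‖ ^ 2 ≤ 2 * ‖z‖ ^ 2 + 2 * ‖v‖ ^ 2 := by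
    have := norm_add_le z v
    nlinarith [sq_nonneg (‖z‖ - ‖v‖), norm_nonneg (z + v)]
  have h5 : δ * ‖z + v‖ ^ 2 ≤ c / 256 * (2 * ‖z‖ ^ 2 + 2 * ‖v‖ ^ 2) := by
    gcongr
    linarith
  have h6 : C * ‖z‖ * ‖v‖ ≤ c / 32 * ‖v‖ ^ 2 + 8 * (C ^ 2 / c * ‖z‖ ^ 2) := by
    have : c / 32 * ‖v‖ ^ 2 + 8 * (C ^ 2 / c * ‖z‖ ^ 2) - C * ‖z‖ * ‖v‖
        = (c * ‖v‖ - 16 * C * ‖z‖) ^ 2 / (32 * c) := by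
      field_simp
      ring
    have h7 : 0 ≤ (c * ‖v‖ - 16 * C * ‖z‖) ^ 2 / (32 * c) := by positivity
    linarith
  have h7 : C ≤ C ^ 2 / c := by rw [le_div_iff₀ hc]; nlinarith
  have h8 : C * ‖z‖ ^ 2 ≤ C ^ 2 / c * ‖z‖ ^ 2 := by gcongr
  have h9 : c * ‖z‖ ^ 2 ≤ C * ‖z‖ ^ 2 := by gcongr
  have h10 : 68 * (C ^ 2 / c * ‖z‖ ^ 2) ≤ |l| := by
    have : 68 * (C ^ 2 / c * ‖z‖ ^ 2) = 68 * C ^ 2 * ‖z‖ ^ 2 / c := by ring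
    rw [this, div_le_iff₀ hc]
    linarith
  nlinarith

theorem exists_isClosestPoint (hf : Continuous f) (hne : ∃ q, f q ≤ l ∧ q - z ∈ Xᗮ) :
    ∃ p, IsClosestPoint f l z X p := by
  have hclosed : IsClosed {q | f q ≤ l ∧ q - z ∈ Xᗮ} :=
    (isClosed_le hf continuous_const).inter
      ((Submodule.closed_of_finiteDimensional Xᗮ).preimage (by fun_prop))
  obtain ⟨p, hp, hd⟩ := hclosed.exists_infDist_eq_dist hne z
  exact ⟨p, hp, fun q hq hqX => hd ▸ Metric.infDist_le_dist_of_mem ⟨hq, hqX⟩⟩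

/-! ### The subspace-finding algorithm -/

namespace OptimalSetting

/-- The tolerance up to which the constructed subspaces are invariant under the Hessian. -/
noncomputable def tol (c : ℝ) (m : ℕ) : ℝ := c / (32 * ((m : ℝ) + 1) ^ 2)

/-- The midpoint of the optimal pair is so close to the critical point that the subspace-finding
algorithm works. -/
structure Centered (c C δ l : ℝ) (m : ℕ) (z : RSpace n) : Prop where
  tol_le : 2 * δ ≤ tol c m
  norm_le : 68 * C ^ 2 * ‖z‖ ^ 2 ≤ c * |l|
  norm_le_tol : 16 * C ^ 3 * ‖z‖ ^ 2 ≤ tol c m ^ 2 * |l|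

theorem nearlyInvariant_sup_span (h : OptimalSetting f G H N m c C δ R r l S x y)
    (hz : Centered c C δ l m z) {j : ℕ}
    (hX : NearlyInvariant H X j (j * tol c m) (c / 8 - j ^ 2 * tol c m)) (hu : u ∈ Xᗮ)
    (hun : c * ‖u‖ ^ 2 ≤ 8 * |l|) (hR : ‖z + u‖ < R) (hf : f (z + u) ≤ l)
    (hG : ∀ w ∈ Xᗮ, inner ℝ u w = 0 → inner ℝ (G (z + u)) w = 0) :
    NearlyInvariant H (X ⊔ Submodule.span ℝ {u}) (j + 1) ((j + 1 : ℕ) * tol c m)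
      (c / 8 - (j + 1 : ℕ) ^ 2 * tol c m) := by
  have hc := h.form.c_pos
  have htol : 0 < tol c m := by unfold tol; positivity
  have h1 := h.model.inner_hessian_le_neg_level h.form h.δ_nonneg h.δ_le h.level_neg hz.norm_le
    hun hR hf
  have hl0 : 0 < |l| := abs_pos.2 h.level_neg.ne
  have hu0 : u ≠ 0 := by
    rintro rfl
    simp at h1
    exact h.level_neg.ne h1
  have h2 := hX.sup_span h.form (by positivity) htol.le hu hu0 (by
      have : 0 ≤ j ^ 2 * tol c m * ‖u‖ ^ 2 := by positivity
      nlinarith)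
    (fun w hw huw => h.model.abs_inner_hessian_le h.form h.δ_le htol.le hz.tol_le hz.norm_le_tol
      hR h.δ_nonneg h1 (hG w hw huw))
  refine ⟨h2.finrank_eq, fun v hv w hw => (h2.cross v hv w hw).trans_eq (by push_cast; ring),
    fun v hv => (h2.neg v hv).trans ?_⟩
  push_cast
  have : 0 ≤ j * tol c m * ‖v‖ ^ 2 := by positivity
  nlinarith

theorem norm_sub_sq_le_of_isClosestPoint (h : OptimalSetting f G H N m c C δ R r l S x y)
    (hz : Centered c C δ l m z) (hX : Module.finrank ℝ X < m) (hp : IsClosestPoint f l z X p) :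
    c * ‖p - z‖ ^ 2 ≤ 8 * |l| := by
  have hc := h.form.c_pos
  obtain ⟨v, hv, hfv, hvn⟩ := h.model.exists_le_level h.form h.δ_nonneg h.δ_le h.r_lt.le h.r_pos
    h.level_neg h.level_small hz.norm_le hX
  have h1 := hp.2 _ hfv (by rwa [add_sub_cancel_left])
  rw [dist_comm, dist_eq_norm, dist_self_add_right] at h1
  rw [← hvn]
  gcongr

theorem norm_lt_of_centered (h : OptimalSetting f G H N m c C δ R r l S x y)
    (hz : Centered c C δ l m z) : 3 * C * ‖z‖ < c * r := by
  have hc := h.form.c_pos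
  have hC := h.form.c_le
  have hC0 : 0 < C := hc.trans_le hC
  have h1 := h.level_small
  have h2 := hz.norm_le
  have hl0 : 0 < |l| := abs_pos.2 h.level_neg.ne
  refine lt_of_pow_lt_pow_left₀ 2 (by have := h.r_pos; positivity) ?_
  have h3 : c * |l| ≤ C * |l| := by gcongr
  nlinarith

theorem norm_add_lt (h : OptimalSetting f G H N m c C δ R r l S x y)
    (hz : Centered c C δ l m z) (hu : c * ‖u‖ ^ 2 ≤ 8 * |l|) : ‖z + u‖ < R := by
  have hc := h.form.c_pos
  have hC := h.form.c_le
  have hC0 : 0 < C := hc.trans_le hC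
  have hr := h.r_pos
  have h1 := h.norm_lt_of_centered hz
  have h2 : ‖z‖ < r / 3 := by
    have : c * ‖z‖ ≤ C * ‖z‖ := by gcongr
    refine lt_of_mul_lt_mul_left ?_ hc.le
    linarith
  have h3 : ‖u‖ < r / 2 := by
    refine lt_of_pow_lt_pow_left₀ 2 (by positivity) ?_
    refine lt_of_mul_lt_mul_left ?_ (by positivity : 0 ≤ c ^ 2)
    have h4 := h.level_small
    have h5 : c * (c * ‖u‖ ^ 2) ≤ C * (8 * |l|) := by gcongr
    nlinarith [abs_nonneg l]
  linarith [norm_add_le z u, h.r_lt]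

theorem nearlyInvariant_of_findSubspace (h : OptimalSetting f G H N m c C δ R r l S x y)
    (hz : Centered c C δ l m (midpoint ℝ x y)) {j : ℕ} (hX : FindSubspace f l x y j X)
    (hj : j ≤ m) : NearlyInvariant H X j (j * tol c m) (c / 8 - j ^ 2 * tol c m) := by
  have hc := h.form.c_pos
  induction hX with
  | start =>
    have hxz : x - midpoint ℝ x y = (2⁻¹ : ℝ) • (x - y) := by
      rw [midpoint_eq_smul_add, invOf_eq_inv]; module
    have hspan : Submodule.span ℝ {x - y} = ⊥ ⊔ Submodule.span ℝ {x - midpoint ℝ x y} := by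
      rw [bot_sup_eq, hxz, Submodule.span_singleton_smul_eq (IsUnit.mk0 _ (by norm_num))]
    rw [hspan]
    have hf : f (midpoint ℝ x y + (x - midpoint ℝ x y)) ≤ l := by
      rw [add_sub_cancel, h.map_left]
    have hn : c * ‖x - midpoint ℝ x y‖ ^ 2 ≤ 8 * |l| := by
      have := h.dist_sq_le
      rw [le_div_iff₀ hc, dist_eq_norm] at this
      rw [hxz, norm_smul, mul_pow]
      norm_num
      linarith [abs_nonneg l]
    have := h.nearlyInvariant_sup_span hz (j := 0) (X := ⊥)
      (by simpa using nearlyInvariant_bot (c / 8)) (u := x - midpoint ℝ x y) (by simp) hn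
      (by rw [add_sub_cancel]; exact h.norm_left_lt.trans h.r_lt) hf (by
        intro w _ hw
        rw [add_sub_cancel]
        refine h.inner_grad_left_eq_zero ?_
        rw [hxz, inner_smul_left] at hw
        simpa using hw)
    simpa using this
  | @extend j X p hX hp ih =>
    have ihX := ih (by omega)
    have hdim : Module.finrank ℝ X < m := by rw [ihX.finrank_eq]; omega
    have hn := h.norm_sub_sq_le_of_isClosestPoint hz hdim hp
    have hR := h.norm_add_lt hz hn
    have hf : f (midpoint ℝ x y + (p - midpoint ℝ x y)) ≤ l := by
      rw [add_sub_cancel]; exact hp.1.1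
    have hneg := h.model.inner_hessian_le_neg_level h.form h.δ_nonneg h.δ_le h.level_neg
      hz.norm_le hn hR hf
    refine h.nearlyInvariant_sup_span hz ihX hp.1.2 hn hR hf fun w hw hpw => ?_
    rw [add_sub_cancel]
    refine hp.inner_grad_eq_zero h.model ?_ hw hpw
    rintro rfl
    simp at hneg
    exact h.level_neg.ne hneg

theorem exists_findSubspace (h : OptimalSetting f G H N m c C δ R r l S x y)
    (hz : Centered c C δ l m (midpoint ℝ x y)) {j : ℕ} (hj1 : 1 ≤ j) (hj : j ≤ m) :
    ∃ X, FindSubspace f l x y j X := by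
  induction j, hj1 using Nat.le_induction with
  | base => exact ⟨_, .start⟩
  | succ j _ ih =>
    obtain ⟨X, hX⟩ := ih (by omega)
    have hdim : Module.finrank ℝ X < m := by
      rw [(h.nearlyInvariant_of_findSubspace hz hX (by omega)).finrank_eq]; omega
    obtain ⟨v, hv, hfv, -⟩ := h.model.exists_le_level h.form h.δ_nonneg h.δ_le h.r_lt.le h.r_pos
      h.level_neg h.level_small hz.norm_le hdim
    obtain ⟨p, hp⟩ := exists_isClosestPoint h.model.continuous
      ⟨midpoint ℝ x y + v, hfv, by rwa [add_sub_cancel_left]⟩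
    exact ⟨_, .extend hX hp⟩

theorem le_inner_of_findSubspace (h : OptimalSetting f G H N m c C δ R r l S x y)
    (hz : Centered c C δ l m (midpoint ℝ x y)) (hX : FindSubspace f l x y m X) :
    Module.finrank ℝ X = m ∧ ∀ w ∈ Xᗮ, c / 2 * ‖w‖ ^ 2 ≤ inner ℝ (H w) w := by
  have hc := h.form.c_pos
  have h1 := h.nearlyInvariant_of_findSubspace hz hX le_rfl
  have htol : 0 < tol c m := by unfold tol; positivity
  have h2 : ((m : ℝ) + 1) ^ 2 * tol c m = c / 32 := by
    unfold tol
    field_simp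
  have hm0 : (0 : ℝ) ≤ m := Nat.cast_nonneg m
  have h3 : (m : ℝ) ^ 2 * tol c m ≤ c / 32 := by
    rw [← h2]; gcongr; linarith
  have h4 : (m : ℝ) * tol c m ≤ c / 32 := by
    rw [← h2]; gcongr; nlinarith
  exact ⟨h1.finrank_eq, fun w hw => h1.le_inner_of_mem_orthogonal h.form (by linarith)
    (by positivity) (by linarith) hw⟩

end OptimalSetting

end

/-! ### Rates of convergence -/

theorem QSuperlinear.qLinear {α : ℕ → ℝ} (h : QSuperlinear α) (h0 : ∀ i, 0 ≤ α i) :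
    QLinear α := by
  refine ⟨h.1, 1 / 2, by norm_num, by norm_num, ?_⟩
  filter_upwards [isLittleO_iff.1 h.2 (c := 1 / 2) (by norm_num)] with i hi
  rwa [Real.norm_of_nonneg (h0 _), Real.norm_of_nonneg (h0 _)] at hi

theorem RSuperlinear.rLinear {α : ℕ → ℝ} (h : RSuperlinear α) : RLinear α := by
  obtain ⟨β, h0, h1, h2⟩ := h
  exact ⟨β, h0, h1.qLinear fun i => (h0 i).le, h2⟩

theorem QSuperlinear.rSuperlinear_of_le_sqrt {α γ : ℕ → ℝ} {A : ℝ} (h : QSuperlinear α)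
    (h0 : ∀ i, 0 ≤ α i) (hA : 0 ≤ A) (hγ : ∀ i, γ i ≤ √(A * α i)) : RSuperlinear γ := by
  have hfac : ∀ i : ℕ, (0 : ℝ) < 1 / (i.factorial : ℝ) := fun i => by positivity
  have hpos : ∀ i, 0 < √(A * α i) + 1 / (i.factorial : ℝ) := fun i =>
    add_pos_of_nonneg_of_pos (Real.sqrt_nonneg _) (hfac i)
  refine ⟨fun i => √(A * α i) + 1 / (i.factorial : ℝ), hpos, ⟨?_, ?_⟩,
    fun i => (hγ i).trans (le_add_of_nonneg_right (hfac i).le)⟩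
  · have h1 : Tendsto (fun i => √(A * α i)) atTop (𝓝 0) := by
      have := (Real.continuous_sqrt.tendsto _).comp (h.1.const_mul A)
      rw [mul_zero, Real.sqrt_zero] at this
      exact this
    have h2 : Tendsto (fun i : ℕ => 1 / (i.factorial : ℝ)) atTop (𝓝 0) := by
      simpa using FloorSemiring.tendsto_pow_div_factorial_atTop (1 : ℝ)
    simpa using h1.add h2
  · refine isLittleO_iff.2 fun ε hε => ?_
    filter_upwards [isLittleO_iff.1 h.2 (c := ε ^ 2) (by positivity),
      tendsto_one_div_add_atTop_nhds_zero_nat.eventually_le_const hε] with i h1 h2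
    rw [Real.norm_of_nonneg (hpos _).le, Real.norm_of_nonneg (hpos _).le, mul_add]
    rw [Real.norm_of_nonneg (h0 _), Real.norm_of_nonneg (h0 _)] at h1
    refine add_le_add ?_ ?_
    · calc √(A * α (i + 1)) ≤ √(ε ^ 2 * (A * α i)) := by
            refine Real.sqrt_le_sqrt ?_
            calc A * α (i + 1) ≤ A * (ε ^ 2 * α i) := by gcongr
              _ = _ := by ring
        _ = _ := by rw [Real.sqrt_mul (by positivity), Real.sqrt_sq hε.le]
    · rw [Nat.factorial_succ]
      push_cast
      calc 1 / (((i : ℝ) + 1) * i.factorial) = 1 / ((i : ℝ) + 1) * (1 / i.factorial) := by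
            field_simp
        _ ≤ _ := by gcongr

/-! ### One iteration -/

section

variable {f : RSpace n → ℝ} {G : RSpace n → RSpace n} {H : RSpace n →L[ℝ] RSpace n}
  {N : Submodule ℝ (RSpace n)} {m : ℕ} {c C δ R r l : ℝ} {S : AffineSubspace ℝ (RSpace n)}
  {x y : RSpace n}

/-- The factor in the bound of the midpoint of an optimal pair. -/
noncomputable def midpointConst (c C : ℝ) : ℝ := 4 * 24576 ^ 2 * C ^ 3 / c ^ 6

/-- `δ` is small with respect to the Hessian. -/
structure Fine (c C δ : ℝ) (m : ℕ) : Prop where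
  pos : 0 < δ
  le : 256 * δ < c
  le_tol : 2 * δ < OptimalSetting.tol c m
  norm_le : 68 * C ^ 2 * (midpointConst c C * δ ^ 2) < c
  norm_le_tol : 16 * C ^ 3 * (midpointConst c C * δ ^ 2) < OptimalSetting.tol c m ^ 2
  level_le : 8 * C ^ 2 / c * (midpointConst c C * δ ^ 2) < 1 / 2

theorem exists_fine (hc : 0 < c) (m : ℕ) : ∃ δ, Fine c C δ m := by
  have htol : 0 < OptimalSetting.tol c m := by unfold OptimalSetting.tol; positivity
  have key : ∀ A K B : ℝ, 0 < B → ∀ᶠ δ in 𝓝[>] (0 : ℝ), A * (K * δ ^ 2) < B := fun A K B hB => by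
    have hcont : ContinuousAt (fun δ : ℝ => A * (K * δ ^ 2)) 0 := by fun_prop
    exact (hcont.eventually_lt_const (by simpa using hB)).filter_mono nhdsWithin_le_nhds
  have key' : ∀ A B : ℝ, 0 < B → ∀ᶠ δ in 𝓝[>] (0 : ℝ), A * δ < B := fun A B hB => by
    have hcont : ContinuousAt (fun δ : ℝ => A * δ) 0 := by fun_prop
    exact (hcont.eventually_lt_const (by simpa using hB)).filter_mono nhdsWithin_le_nhds
  have hmem : ∀ᶠ δ in 𝓝[>] (0 : ℝ), 0 < δ := self_mem_nhdsWithin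
  obtain ⟨δ, h1, h2, h3, h4, h5, h6⟩ := (hmem.and
    ((key' 256 c hc).and ((key' 2 _ htol).and ((key (68 * C ^ 2) (midpointConst c C) c hc).and
    ((key (16 * C ^ 3) (midpointConst c C) _ (pow_pos htol 2)).and
    (key (8 * C ^ 2 / c) (midpointConst c C) (1 / 2) (by norm_num))))))).exists
  exact ⟨δ, h1, h2, h3, h4, h5, h6⟩

namespace OptimalSetting

theorem centered (h : OptimalSetting f G H N m c C δ R r l S x y) (hδ : Fine c C δ m) :
    Centered c C δ l m (midpoint ℝ x y) := by
  have hC : 0 < C := h.form.c_pos.trans_le h.form.c_le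
  have h1 := h.norm_midpoint_sq_le h.model h.δ_nonneg (h.norm_left_lt.trans h.r_lt)
    (h.symm.norm_left_lt.trans h.r_lt)
  refine ⟨hδ.le_tol.le, ?_, ?_⟩
  · calc _ ≤ 68 * C ^ 2 * (midpointConst c C * δ ^ 2 * |l|) := by gcongr; exact h1
      _ = 68 * C ^ 2 * (midpointConst c C * δ ^ 2) * |l| := by ring
      _ ≤ _ := by gcongr; exact hδ.norm_le.le
  · calc _ ≤ 16 * C ^ 3 * (midpointConst c C * δ ^ 2 * |l|) := by gcongr; exact h1
      _ = 16 * C ^ 3 * (midpointConst c C * δ ^ 2) * |l| := by ring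
      _ ≤ _ := by gcongr; exact hδ.norm_le_tol.le

/-- The next level exists and is nonpositive; its size compared with the present level is governed
by the deviation of `f` from its quadratic part near the two points. -/
theorem exists_next (h : OptimalSetting f G H N m c C δ R r l S x y) (hδ : Fine c C δ m)
    {L : Submodule ℝ (RSpace n)} (hL : Module.finrank ℝ L = m)
    (hpos : ∀ u ∈ Lᗮ, c / 4 * ‖u‖ ^ 2 ≤ inner ℝ (H u) u) :
    ∃ l', IsNextLevel f (Metric.ball 0 r) x y L l' ∧ l' ≤ 0 ∧
      ∀ δ' R' : ℝ, QuadModel f G H δ' R' → 0 ≤ δ' → ‖x‖ < R' → ‖y‖ < R' →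
        |l'| ≤ 8 * C ^ 2 / c * (midpointConst c C * δ' ^ 2) * |l| := by
  have hc := h.form.c_pos
  obtain ⟨l', h1, h2, h3⟩ := exists_isNextLevel h.model h.form h.δ_nonneg
    (by linarith [h.δ_le, h.δ_nonneg]) h.r_lt.le hL hpos (h.norm_lt_of_centered (h.centered hδ))
  refine ⟨l', h1, h3, fun δ' R' hm hδ' hx hy => ?_⟩
  have h4 := h.norm_midpoint_sq_le hm hδ' hx hy
  rw [abs_of_nonpos h3]
  calc -l' ≤ 8 * C ^ 2 / c * ‖midpoint ℝ x y‖ ^ 2 := by linarith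
    _ ≤ 8 * C ^ 2 / c * (midpointConst c C * δ' ^ 2 * |l|) := by gcongr; exact h4
    _ = _ := by ring

theorem abs_next_le (h : OptimalSetting f G H N m c C δ R r l S x y) (hδ : Fine c C δ m) {l' : ℝ}
    (hl' : ∀ δ' R' : ℝ, QuadModel f G H δ' R' → 0 ≤ δ' → ‖x‖ < R' → ‖y‖ < R' →
        |l'| ≤ 8 * C ^ 2 / c * (midpointConst c C * δ' ^ 2) * |l|) : |l'| ≤ 1 / 2 * |l| :=
  (hl' δ R h.model h.δ_nonneg (h.norm_left_lt.trans h.r_lt)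
    (h.symm.norm_left_lt.trans h.r_lt)).trans (by gcongr; exact hδ.level_le.le)

theorem le_inner_of_approxSubspace
    (h : OptimalSetting f G H (negEigenspace f 0) m c C δ R r l S x y)
    (hδ : Fine c C δ m) {L : Submodule ℝ (RSpace n)}
    (hL : ApproxSubspace f m (c / (16 * C)) l x y L) {u : RSpace n} (hu : u ∈ Lᗮ) :
    c / 4 * ‖u‖ ^ 2 ≤ inner ℝ (H u) u := by
  have hc := h.form.c_pos
  rcases hL.2 with h1 | ⟨X, hX, h1⟩
  · refine h.form.le_inner_of_starProjection (fun w hw => ?_) h1 hu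
    refine le_trans ?_ (h.form.pos w hw)
    gcongr
    linarith
  · exact h.form.le_inner_of_starProjection
      (h.le_inner_of_findSubspace (h.centered hδ) hX).2 h1 hu

end OptimalSetting

/-! ### Convergence of runs -/

theorem superlinear_of_isRun (hH : SaddleForm H N m c C) (hm : 1 ≤ m)
    (hQ : ∀ δ : ℝ, 0 < δ → ∃ R > 0, QuadModel f G H δ R) (hδ : Fine c C δ m)
    (hQR : QuadModel f G H δ R) (hr0 : 0 < r) (hr : r < R)
    {Sel : ℝ → RSpace n → RSpace n → Submodule ℝ (RSpace n) → Prop}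
    (hSel : ∀ l S x y L, OptimalSetting f G H N m c C δ R r l S x y → Sel l x y L →
      Module.finrank ℝ L = m ∧ ∀ u ∈ Lᗮ, c / 4 * ‖u‖ ^ 2 ≤ inner ℝ (H u) u)
    {l : ℕ → ℝ} {x y : ℕ → RSpace n} (hl0 : l 0 ≤ 0)
    (hl0r : 6144 * C * |l 0| < c ^ 2 * r ^ 2)
    (hrun : IsRun f m (Metric.ball 0 r) Sel l x y) :
    RSuperlinear (fun i => ‖x i‖) ∧ RSuperlinear (fun i => ‖y i‖) ∧
      RSuperlinear (fun i => ‖midpoint ℝ (x i) (y i)‖) ∧ QSuperlinear (fun i => |l i|) := by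
  have hc := hH.c_pos
  have hC : 0 < C := hc.trans_le hH.c_le
  have hset : ∀ i, l i < 0 → |l i| ≤ |l 0| →
      ∃ S, OptimalSetting f G H N m c C δ R r (l i) S (x i) (y i) := by
    intro i hi hi0
    obtain ⟨S, hS⟩ := (hrun i).1
    refine ⟨S, hQR, hH, hm, hr0, hr, hδ.pos.le, hδ.le.le, hi, lt_of_le_of_lt ?_ hl0r, hS⟩
    gcongr
  have hzero : ∀ i, l i = 0 → x i = 0 ∧ y i = 0 := by
    intro i hi
    obtain ⟨S, hS⟩ := (hrun i).1
    rw [hi] at hS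
    exact eq_zero_of_level_zero hQR hr.le hr0 hδ.pos.le hH (by linarith [hδ.le, hδ.pos]) hm hS.1
  have hstep : ∀ i, l i ≤ 0 → |l i| ≤ |l 0| → l (i + 1) ≤ 0 ∧ |l (i + 1)| ≤ 1 / 2 * |l i| ∧
      ∀ δ' R' : ℝ, QuadModel f G H δ' R' → 0 ≤ δ' → ‖x i‖ < R' → ‖y i‖ < R' →
        |l (i + 1)| ≤ 8 * C ^ 2 / c * (midpointConst c C * δ' ^ 2) * |l i| := by
    intro i hi hi0
    rcases hi.lt_or_eq with hlt | heq
    · obtain ⟨S, hS⟩ := hset i hlt hi0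
      obtain ⟨L, hL, hnext⟩ := (hrun i).2.2 hS.ne
      obtain ⟨hLm, hLpos⟩ := hSel _ _ _ _ _ hS hL
      obtain ⟨l', h1, h2, h3⟩ := hS.exists_next hδ hLm hLpos
      rw [hnext.unique h1]
      exact ⟨h2, hS.abs_next_le hδ h3, h3⟩
    · obtain ⟨hx, hy⟩ := hzero i heq
      have := (hrun i).2.1 (hx.trans hy.symm)
      rw [this, heq]
      simp
  have hinv : ∀ i, l i ≤ 0 ∧ |l i| ≤ |l 0| ∧ |l i| ≤ (1 / 2) ^ i * |l 0| := by
    intro i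
    induction i with
    | zero => simp [hl0]
    | succ i ih =>
      obtain ⟨h1, h2, -⟩ := hstep i ih.1 ih.2.1
      have := abs_nonneg (l i)
      refine ⟨h1, by linarith [ih.2.1], ?_⟩
      rw [pow_succ]
      linarith [ih.2.2]
  have hnorm : ∀ i, c ^ 2 * ‖x i‖ ^ 2 ≤ 6144 * C * |l i| ∧ c ^ 2 * ‖y i‖ ^ 2 ≤ 6144 * C * |l i| := by
    intro i
    rcases (hinv i).1.lt_or_eq with hlt | heq
    · obtain ⟨S, hS⟩ := hset i hlt (hinv i).2.1
      exact ⟨hS.norm_left_sq_le, hS.symm.norm_left_sq_le⟩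
    · obtain ⟨hx, hy⟩ := hzero i heq
      simp [hx, hy, heq]
  have hsqrt : ∀ i, ‖x i‖ ≤ √(6144 * C / c ^ 2 * |l i|) ∧ ‖y i‖ ≤ √(6144 * C / c ^ 2 * |l i|) := by
    intro i
    constructor
    · refine Real.le_sqrt_of_sq_le ?_
      rw [div_mul_eq_mul_div, le_div_iff₀ (by positivity)]
      linarith [(hnorm i).1]
    · refine Real.le_sqrt_of_sq_le ?_
      rw [div_mul_eq_mul_div, le_div_iff₀ (by positivity)]
      linarith [(hnorm i).2]
  have htend : Tendsto (fun i => |l i|) atTop (𝓝 0) := by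
    refine squeeze_zero (fun i => abs_nonneg _) (fun i => (hinv i).2.2) ?_
    have := (tendsto_pow_atTop_nhds_zero_of_lt_one (r := (1 / 2 : ℝ)) (by norm_num)
      (by norm_num)).mul_const |l 0|
    simpa using this
  have hstend : Tendsto (fun i => √(6144 * C / c ^ 2 * |l i|)) atTop (𝓝 0) := by
    have := (Real.continuous_sqrt.tendsto _).comp (htend.const_mul (6144 * C / c ^ 2))
    rw [mul_zero, Real.sqrt_zero] at this
    exact this
  have hQS : QSuperlinear (fun i => |l i|) := by
    refine ⟨htend, isLittleO_iff.2 fun ε hε => ?_⟩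
    obtain ⟨δ', hδ'0, hδ'⟩ : ∃ δ' : ℝ, 0 < δ' ∧
        8 * C ^ 2 / c * (midpointConst c C * δ' ^ 2) < ε := by
      have hcont : ContinuousAt
          (fun δ' : ℝ => 8 * C ^ 2 / c * (midpointConst c C * δ' ^ 2)) 0 := by fun_prop
      obtain ⟨δ', h1, h2⟩ := (((hcont.eventually_lt_const (u := ε) (by simpa using hε)).filter_mono
        nhdsWithin_le_nhds).and (self_mem_nhdsWithin (s := Set.Ioi (0 : ℝ)))).exists
      exact ⟨δ', h2, h1⟩
    obtain ⟨R', hR', hQ'⟩ := hQ δ' hδ'0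
    filter_upwards [hstend.eventually_lt_const hR'] with i hi
    rw [Real.norm_of_nonneg (abs_nonneg _), Real.norm_of_nonneg (abs_nonneg _)]
    refine ((hstep i (hinv i).1 (hinv i).2.1).2.2 δ' R' hQ' hδ'0.le ((hsqrt i).1.trans_lt hi)
      ((hsqrt i).2.trans_lt hi)).trans ?_
    gcongr
  refine ⟨?_, ?_, ?_, hQS⟩
  · exact hQS.rSuperlinear_of_le_sqrt (fun i => abs_nonneg _) (by positivity) fun i => (hsqrt i).1
  · exact hQS.rSuperlinear_of_le_sqrt (fun i => abs_nonneg _) (by positivity) fun i => (hsqrt i).2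
  · refine hQS.rSuperlinear_of_le_sqrt (A := 6144 * C / c ^ 2) (fun i => abs_nonneg _)
      (by positivity) fun i => ?_
    rw [midpoint_eq_smul_add, invOf_eq_inv, norm_smul, Real.norm_of_nonneg (by norm_num)]
    linarith [norm_add_le (x i) (y i), (hsqrt i).1, (hsqrt i).2]

end

end LevelSet

theorem mainTheorem1 {n : ℕ} (m : ℕ) (hm : 1 ≤ m) (f : RSpace n → ℝ) (hf : ContDiff ℝ 2 f)
    (hcrit : LevelSet.IsNondegenerateCriticalPoint f 0) (hindex : LevelSet.HasMorseIndex f 0 m)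
    (hf0 : f 0 = 0) :
    ∃ ε : ℝ, 0 < ε ∧ ∃ R : ℝ, 0 < R ∧ ∀ r : ℝ, 0 < r → r < R → ∃ η : ℝ, 0 < η ∧
      -- an iteration that starts from an optimizing triple as required can be carried out
      (∀ (l : ℝ) (S : AffineSubspace ℝ (RSpace n)) (x y : RSpace n), -η < l → l < 0 →
        LevelSet.IsUniqueOptimizingTriple f m (Metric.ball 0 r) l S x y →
        x ≠ y ∧ (∃ X, LevelSet.FindSubspace f l x y m X) ∧
        ∀ X, LevelSet.FindSubspace f l x y m X → Module.finrank ℝ X = m ∧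
          ∃ l' : ℝ, l < l' ∧ l' ≤ 0 ∧ LevelSet.IsNextLevel f (Metric.ball 0 r) x y X l') ∧
      -- superlinear convergence with the subspace-finding algorithm
      (∀ (l : ℕ → ℝ) (x y : ℕ → RSpace n), -η < l 0 → l 0 < 0 →
        LevelSet.IsRun f m (Metric.ball 0 r)
          (fun l x y L => LevelSet.FindSubspace f l x y m L) l x y →
        LevelSet.RSuperlinear (fun i => ‖x i‖) ∧ LevelSet.RSuperlinear (fun i => ‖y i‖) ∧
        LevelSet.RSuperlinear (fun i => ‖midpoint ℝ (x i) (y i)‖) ∧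
        LevelSet.QSuperlinear (fun i => |l i|)) ∧
      -- linear convergence with approximate lineality spaces
      (∀ (l : ℕ → ℝ) (x y : ℕ → RSpace n), -η < l 0 → l 0 < 0 →
        LevelSet.IsRun f m (Metric.ball 0 r) (LevelSet.ApproxSubspace f m ε) l x y →
        LevelSet.RLinear (fun i => ‖x i‖) ∧ LevelSet.RLinear (fun i => ‖y i‖) ∧
        LevelSet.RLinear (fun i => ‖midpoint ℝ (x i) (y i)‖) ∧
        LevelSet.QLinear (fun i => |l i|)) := by
  obtain ⟨c, C, hH⟩ := LevelSet.exists_saddleForm hf hcrit hindex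
  have hc := hH.c_pos
  have hC : 0 < C := hc.trans_le hH.c_le
  have hQ : ∀ δ : ℝ, 0 < δ → ∃ R > 0,
      LevelSet.QuadModel f (gradient f) (LevelSet.hessian f 0) δ R := fun δ hδ =>
    LevelSet.exists_quadModel hf hcrit.1 hf0 hδ
  obtain ⟨δ, hδ⟩ := LevelSet.exists_fine (C := C) hc m
  obtain ⟨R, hR, hQR⟩ := hQ δ hδ.pos
  refine ⟨c / (16 * C), by positivity, R, hR, fun r hr0 hr => ?_⟩
  have hη : ∀ l : ℝ, -(c ^ 2 * r ^ 2 / (6144 * C)) < l → l < 0 →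
      6144 * C * |l| < c ^ 2 * r ^ 2 := by
    intro l h1 h2
    rw [abs_of_neg h2, mul_comm]
    exact (lt_div_iff₀ (by positivity)).1 (by linarith)
  have hpos : ∀ {X : Submodule ℝ (RSpace n)},
      (∀ w ∈ Xᗮ, c / 2 * ‖w‖ ^ 2 ≤ inner ℝ (LevelSet.hessian f 0 w) w) →
      ∀ w ∈ Xᗮ, c / 4 * ‖w‖ ^ 2 ≤ inner ℝ (LevelSet.hessian f 0 w) w := fun h w hw => by
    refine le_trans ?_ (h w hw)
    gcongr
    norm_num
  refine ⟨c ^ 2 * r ^ 2 / (6144 * C), by positivity, fun l S x y h1 h2 h3 => ?_,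
    fun l x y h1 h2 h3 => ?_, fun l x y h1 h2 h3 => ?_⟩
  · have hS : LevelSet.OptimalSetting f (gradient f) (LevelSet.hessian f 0)
        (LevelSet.negEigenspace f 0) m c C δ R r l S x y :=
      ⟨hQR, hH, hm, hr0, hr, hδ.pos.le, hδ.le.le, h2, hη l h1 h2, h3⟩
    refine ⟨hS.ne, hS.exists_findSubspace (hS.centered hδ) hm le_rfl, fun X hX => ?_⟩
    obtain ⟨hX1, hX2⟩ := hS.le_inner_of_findSubspace (hS.centered hδ) hX
    obtain ⟨l', h4, h5, h6⟩ := hS.exists_next hδ hX1 (hpos hX2)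
    have h7 := hS.abs_next_le hδ h6
    rw [abs_of_nonpos h5, abs_of_neg h2] at h7
    exact ⟨hX1, l', by linarith, h5, h4⟩
  · refine LevelSet.superlinear_of_isRun hH hm hQ hδ hQR hr0 hr ?_ h2.le (hη _ h1 h2) h3
    intro l S x y L hS hL
    obtain ⟨hX1, hX2⟩ := hS.le_inner_of_findSubspace (hS.centered hδ) hL
    exact ⟨hX1, hpos hX2⟩
  · obtain ⟨e1, e2, e3, e4⟩ := LevelSet.superlinear_of_isRun hH hm hQ hδ hQR hr0 hr
      (fun l S x y L hS hL => ⟨hL.1, fun u hu => hS.le_inner_of_approxSubspace hδ hL hu⟩)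
      h2.le (hη _ h1 h2) h3
    exact ⟨e1.rLinear, e2.rLinear, e3.rLinear, e4.qLinear fun i => abs_nonneg _⟩
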